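/- Setting. Fix propositions $p_0,p_1,\dots$. A domain $\Phi$ is a finite set of propositions, a $\Phi$-assignment is a function $s:\Phi\to\{0,1\}$, and a $\Phi$-team $T$ is a set of $\Phi$-assignments. A split of $T$ is a pair $(S,U)$ with $S,U\subseteq T$ and $S\cup U=T$; it is strict if $S\cap U=\emptyset$. Team semantics: $T\vDash\top$ always; $T\vDash\bot$ iff $T=\emptyset$; $T\vDash p$ (resp. $\neg p$) iff $s(p)=1$ (resp. $0$) for all $s\in T$; $T\vDash{\sim}\varphi$ iff $T\nvDash\varphi$; $T\vDash\varphi\wedge\psi$ iff both hold; $T\vDash\varphi\ovee\psi$ (Boolean disjunction) iff $T\vDash\varphi$ or $T\vDash\psi$; $T\vDash\varphi\vee\psi$ (resp. $\varphi\mathbin{\dot\vee}\psi$) iff there is a split (resp. strict split) $(S,U)$ of $T$ with $S\vDash\varphi$ and $U\vDash\psi$; and $\varphi\owedge\psi$ (resp. $\varphi\mathbin{\dot\owedge}\psi$) holds in $T$ iff every split (resp. strict split) $(S,U)$ of $T$ has $S\vDash\varphi$ or $U\vDash\psi$. For a set $\Sigma$ of these connectives (${\sim},\wedge,\ovee,\vee,\dot\vee,\owedge,\dot\owedge$),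 $\mathrm{PL}(\Sigma)$ is the least set that contains all literals $\top,\bot,p,\neg p,{\sim}\top,{\sim}\bot,{\sim}p,{\sim}\neg p$ and is closed under the connectives in $\Sigma$. A purely propositional formula is a ${\sim}$-free $\mathrm{PL}(\{\wedge,\vee\})$-formula. The length $|\varphi|$ is the length of $\varphi$ as a string, each proposition counting as one symbol; the length of a tuple is the sum of the lengths of its entries, and $|\vec\alpha\vec\beta|=|\vec\alpha|+|\vec\beta|$. For purely propositional $\alpha$ let $s(\alpha)=1$ if $\{s\}\vDash\alpha$ and $s(\alpha)=0$ otherwise, and $s(\vec\alpha)=(s(\alpha_1),\dots,s(\alpha_n))$. Atoms, for (possibly empty) tuples $\vec\alpha,\vec\beta,\vec\gamma$ of $n,m,k$ purely propositional formulas ($n=m$ for exclusion and inclusion): - Dependence $T\vDash\mathrm{dep}(\vec\alpha;\vec\beta)$: for all $s,s'\in T$, if $s(\vec\alpha)=s'(\vec\alpha)$ then $s(\vec\beta)=s'(\vec\beta)$. - Exclusion $T\vDash\vec\alpha\mid\vec\beta$: $s(\vec\alpha)\ne s'(\vec\beta)$ for all $s,s'\in T$. - Inclusion $T\vDash\vec\alpha\subseteq\vec\beta$: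 for every $s\in T$ there is $s'\in T$ with $s(\vec\alpha)=s'(\vec\beta)$. - Conditional independence $T\vDash\vec\alpha\perp_{\vec\gamma}\vec\beta$: for all $s,s'\in T$ with $s(\vec\gamma)=s'(\vec\gamma)$ there is $s''\in T$ with $s(\vec\alpha\vec\gamma)=s''(\vec\alpha\vec\gamma)$ and $s'(\vec\beta)=s''(\vec\beta)$. - Unary anonymity $T\vDash\vec\alpha\,\Upsilon\beta$, for a single purely propositional formula $\beta$: for every $s\in T$ there is $s'\in T$ with $s(\vec\alpha)=s'(\vec\alpha)$ and $s(\beta)\ne s'(\beta)$. An atom and a formula are equivalent if they hold in the same $\Phi$-teams, for every domain $\Phi$ that contains the propositions of both. Theorem. Let $\Sigma\supseteq\{\ovee,\wedge,\vee\}$. Each of the following atoms is equivalent to ${\sim}\varphi$ for a $\mathrm{PL}(\Sigma)$-formula $\varphi$ of the stated length, where the constants do not depend on the tuples and a bound whose value is $0$ is to be read as $O(1)$: - $\mathrm{dep}(\vec\alpha;\vec\beta)$, with length $O(|\vec\alpha\vec\beta|)$; - $\vec\alpha\mid\vec\beta$, with length $O(n|\vec\alpha\vec\beta|)$; - $\vec\alpha\subseteq\vec\beta$,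 with length $O(n|\vec\alpha\vec\beta|)$; - $\vec\alpha\perp_{\vec\gamma}\vec\beta$, with length $O(n(n+m+k)|\vec\alpha\vec\beta\vec\gamma|)$; - $\vec\alpha\,\Upsilon\beta$, with length $O(\max(n,1)|\beta|+|\vec\alpha|)$. For the dependence and the exclusion atom the same holds for every $\Sigma\supseteq\{\ovee,\wedge,\mathbin{\dot\vee}\}$. Moreover, in each case the formulas $\varphi$ can be chosen so that the map from the tuples to $\varphi$ is computable in logarithmic space (with formulas encoded as words over a finite alphabet, propositions by their index in binary). -/

import Mathlib

namespace TeamLogic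

/-! ### Syntax of propositional team logic; the atomic propositions are `p₀, p₁, p₂, …` -/

/-- The binary connectives: conjunction, Boolean disjunction, (lax) splitting disjunction,
strict splitting disjunction, and the duals of the two splitting disjunctions. -/
inductive BinConn
  | and
  | bor
  | split
  | strictSplit
  | dualSplit
  | dualStrictSplit
  deriving DecidableEq

/-- The connectives of propositional team logic: the unary contradictory negation and the
binary connectives. -/
inductive Connective
  | snot
  | bin (c : BinConn)
  deriving DecidableEq

/-- Formulas. `nvar p` is the dual negation of `p`, which occurs in front of propositions only;
`snot` is the contradictory (Boolean) negation. -/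
inductive Formula
  | top
  | bot
  | var (p : ℕ)
  | nvar (p : ℕ)
  | snot (φ : Formula)
  | bin (c : BinConn) (φ ψ : Formula)
  deriving DecidableEq

namespace Formula

/-- The literals without contradictory negation. -/
def IsBasic : Formula → Prop
  | top => True
  | bot => True
  | var _ => True
  | nvar _ => True
  | snot _ => False
  | bin _ _ _ => False

/-- The propositions that occur in a formula. -/
def props : Formula → Finset ℕ
  | top => ∅
  | bot => ∅
  | var p => {p}
  | nvar p => {p}
  | snot φ => φ.props
  | bin _ φ ψ => φ.props ∪ ψ.props

/-- Purely propositional formulas: built from the literals without contradictory negation by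
conjunction and splitting disjunction. -/
def IsPure : Formula → Prop
  | top => True
  | bot => True
  | var _ => True
  | nvar _ => True
  | snot _ => False
  | bin BinConn.and φ ψ => φ.IsPure ∧ ψ.IsPure
  | bin BinConn.split φ ψ => φ.IsPure ∧ ψ.IsPure
  | bin _ _ _ => False

end Formula

/-- Membership in `PL(S)`: the smallest set that contains all literals (contradictory negation
in front of a basic literal is always allowed) and is closed under the connectives in `S`. -/
inductive InPL (S : Set Connective) : Formula → Prop
  | basic {φ : Formula} : φ.IsBasic → InPL S φ
  | snotBasic {φ : Formula} : φ.IsBasic → InPL S (Formula.snot φ)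
  | snot {φ : Formula} : Connective.snot ∈ S → InPL S φ → InPL S (Formula.snot φ)
  | bin {c : BinConn} {φ ψ : Formula} :
      Connective.bin c ∈ S → InPL S φ → InPL S ψ → InPL S (Formula.bin c φ ψ)

/-- Purely propositional formulas as a type. -/
abbrev PureFormula : Type := {φ : Formula // φ.IsPure}

/-! ### Formulas as strings and their length -/

/-- Symbols of formula strings; each proposition counts as one symbol. -/
inductive Symbol
  | top
  | bot
  | neg
  | snot
  | bin (c : BinConn)
  | lpar
  | rpar
  | prop (p : ℕ)
  deriving DecidableEq

/-- A formula as a string, with binary connectives written infix in parentheses. -/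
def Formula.symbols : Formula → List Symbol
  | Formula.top => [Symbol.top]
  | Formula.bot => [Symbol.bot]
  | Formula.var p => [Symbol.prop p]
  | Formula.nvar p => [Symbol.neg, Symbol.prop p]
  | Formula.snot φ => Symbol.snot :: φ.symbols
  | Formula.bin c φ ψ =>
      [Symbol.lpar] ++ φ.symbols ++ [Symbol.bin c] ++ ψ.symbols ++ [Symbol.rpar]

/-- The length of a formula as a string. -/
def Formula.length (φ : Formula) : ℕ := φ.symbols.length

/-- The length of a tuple is the sum of the lengths of its entries. -/
def tupleLength (α : List PureFormula) : ℕ := (α.map fun φ => φ.1.length).sum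

/-- The propositions that occur in a tuple. -/
def tupleProps (α : List PureFormula) : Finset ℕ := α.foldr (fun φ s => φ.1.props ∪ s) ∅

/-! ### Team semantics -/

/-- Assignments over a domain, that is, over a finite set of propositions. -/
abbrev Assignment (Φ : Finset ℕ) : Type := Φ → Bool

/-- Teams over a domain. -/
abbrev Team (Φ : Finset ℕ) : Type := Set (Assignment Φ)

/-- The value of a proposition; it is only used for propositions in the domain. -/
def Assignment.get {Φ : Finset ℕ} (s : Assignment Φ) (p : ℕ) : Bool :=
  if h : p ∈ Φ then s ⟨p, h⟩ else false

/-- `(S, U)` is a split of `T`. -/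
def IsSplit {Φ : Finset ℕ} (T S U : Team Φ) : Prop := S ⊆ T ∧ U ⊆ T ∧ S ∪ U = T

/-- `(S, U)` is a strict split of `T`. -/
def IsStrictSplit {Φ : Finset ℕ} (T S U : Team Φ) : Prop := IsSplit T S U ∧ S ∩ U = ∅

/-- The action of a binary connective on properties of teams. -/
def BinConn.sem {Φ : Finset ℕ} (c : BinConn) (A B : Team Φ → Prop) (T : Team Φ) : Prop :=
  match c with
  | BinConn.and => A T ∧ B T
  | BinConn.bor => A T ∨ B T
  | BinConn.split => ∃ S U, IsSplit T S U ∧ A S ∧ B U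
  | BinConn.strictSplit => ∃ S U, IsStrictSplit T S U ∧ A S ∧ B U
  | BinConn.dualSplit => ∀ S U, IsSplit T S U → A S ∨ B U
  | BinConn.dualStrictSplit => ∀ S U, IsStrictSplit T S U → A S ∨ B U

/-- `φ.Sat T` : the team `T` satisfies the formula `φ`. -/
def Formula.Sat {Φ : Finset ℕ} : Formula → Team Φ → Prop
  | Formula.top => fun _ => True
  | Formula.bot => fun T => T = ∅
  | Formula.var p => fun T => ∀ s ∈ T, s.get p = true
  | Formula.nvar p => fun T => ∀ s ∈ T, s.get p = false
  | Formula.snot φ => fun T => ¬ φ.Sat T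
  | Formula.bin c φ ψ => c.sem φ.Sat ψ.Sat

open Classical in
/-- The truth value `s(α)` of a formula under a single assignment. -/
noncomputable def Assignment.value {Φ : Finset ℕ} (s : Assignment Φ) (α : PureFormula) : Bool :=
  decide (α.1.Sat ({s} : Team Φ))

/-- The vector `s(α₁), …, s(αₙ)` of truth values of a tuple under a single assignment. -/
noncomputable def Assignment.values {Φ : Finset ℕ} (s : Assignment Φ) (α : List PureFormula) :
    List Bool :=
  α.map s.value

/-! ### Atoms of dependency -/

/-- The atoms of dependency. In `indep α γ β` the middle tuple is the condition. Inclusion and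
exclusion atoms are meant for tuples of equal length. -/
inductive Atom
  | dep (α β : List PureFormula)
  | excl (α β : List PureFormula)
  | incl (α β : List PureFormula)
  | indep (α γ β : List PureFormula)
  | anon (α β : List PureFormula)

/-- The propositions that occur in an atom. -/
def Atom.props : Atom → Finset ℕ
  | Atom.dep α β => tupleProps α ∪ tupleProps β
  | Atom.excl α β => tupleProps α ∪ tupleProps β
  | Atom.incl α β => tupleProps α ∪ tupleProps β
  | Atom.indep α γ β => tupleProps α ∪ tupleProps γ ∪ tupleProps β
  | Atom.anon α β => tupleProps α ∪ tupleProps β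

/-- `a.Sat T` : the team `T` satisfies the atom `a`. -/
def Atom.Sat {Φ : Finset ℕ} : Atom → Team Φ → Prop
  | Atom.dep α β => fun T =>
      ∀ s ∈ T, ∀ s' ∈ T, s.values α = s'.values α → s.values β = s'.values β
  | Atom.excl α β => fun T => ∀ s ∈ T, ∀ s' ∈ T, s.values α ≠ s'.values β
  | Atom.incl α β => fun T => ∀ s ∈ T, ∃ s' ∈ T, s.values α = s'.values β
  | Atom.indep α γ β => fun T =>
      ∀ s ∈ T, ∀ s' ∈ T, s.values γ = s'.values γ →
        ∃ s'' ∈ T, s.values (α ++ γ) = s''.values (α ++ γ) ∧ s'.values β = s''.values β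
  | Atom.anon α β => fun T =>
      ∀ s ∈ T, ∃ s' ∈ T, s.values α = s'.values α ∧ s.values β ≠ s'.values β

/-- An atom and a formula are equivalent if they are satisfied by the same teams, over every
domain that contains their propositions. -/
def Atom.EquivTo (a : Atom) (φ : Formula) : Prop :=
  ∀ Φ : Finset ℕ, a.props ∪ φ.props ⊆ Φ → ∀ T : Team Φ, a.Sat T ↔ φ.Sat T

/-! ### Logspace computability -/

/-- The finite alphabet over which formulas and tuples are encoded for machines. -/
inductive Letter
  | top
  | bot
  | neg
  | snot
  | bin (c : BinConn)
  | lpar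
  | rpar
  | prop
  | bit (b : Bool)
  | comma
  | semicolon
  deriving DecidableEq

/-- Propositions are encoded by a marker and their index in binary. -/
def Symbol.encode : Symbol → List Letter
  | Symbol.top => [Letter.top]
  | Symbol.bot => [Letter.bot]
  | Symbol.neg => [Letter.neg]
  | Symbol.snot => [Letter.snot]
  | Symbol.bin c => [Letter.bin c]
  | Symbol.lpar => [Letter.lpar]
  | Symbol.rpar => [Letter.rpar]
  | Symbol.prop p => Letter.prop :: (Nat.bits p).map Letter.bit

/-- The encoding of a formula over the finite alphabet. -/
def Formula.encode (φ : Formula) : List Letter := φ.symbols.flatMap Symbol.encode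

/-- The encoding of a tuple: each entry is followed by a comma, the tuple by a semicolon. -/
def encodeTuple (α : List PureFormula) : List Letter :=
  (α.flatMap fun φ => φ.1.encode ++ [Letter.comma]) ++ [Letter.semicolon]

/-- Head movements. -/
inductive Move
  | left
  | stay
  | right
  deriving DecidableEq

/-- The new position of a head on a one-sided infinite tape. -/
def Move.apply : Move → ℕ → ℕ
  | Move.left, i => i - 1
  | Move.stay, i => i
  | Move.right, i => i + 1

/-- What an input head can scan: a letter of the input or one of the two end markers. -/
inductive InputCell
  | leftEnd
  | letter (a : Letter)
  | rightEnd
  deriving DecidableEq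

/-- The content of the input tape for the word `w`: end markers are at position `0` and at
position `w.length + 1`. -/
def inputCell (w : List Letter) : ℕ → InputCell
  | 0 => InputCell.leftEnd
  | i + 1 =>
    match w[i]? with
    | some a => InputCell.letter a
    | none => InputCell.rightEnd

/-- Deterministic Turing machines with output: a two-way read-only input tape, finitely many
two-way read-write work tapes, and a one-way write-only output tape. The machine has
`inputHeads` many heads on the input tape and one head on each of its work tapes. Depending on
its state and the scanned cells, it halts (`none`) or enters a new state, moves the input heads,
writes on each work tape and moves its head, and appends a word to the output. -/
structure Machine where
  State : Type
  finiteState : Finite State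
  start : State
  Work : Type
  finiteWork : Finite Work
  blank : Work
  inputHeads : ℕ
  workTapes : ℕ
  trans : State → (Fin inputHeads → InputCell) → (Fin workTapes → Work) →
    Option (State × (Fin inputHeads → Move) × (Fin workTapes → Work × Move) × List Letter)

/-- Configurations of a machine. -/
structure Machine.Cfg (M : Machine) where
  state : M.State
  inputPos : Fin M.inputHeads → ℕ
  work : Fin M.workTapes → ℕ → M.Work
  workPos : Fin M.workTapes → ℕ
  out : List Letter

/-- The initial configuration. -/
def Machine.init (M : Machine) : M.Cfg where
  state := M.start
  inputPos := fun _ => 0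
  work := fun _ _ => M.blank
  workPos := fun _ => 0
  out := []

/-- One step of a machine on the input `w`; `none` if the machine has halted. The input heads do
not move beyond the end markers. -/
def Machine.step (M : Machine) (w : List Letter) (c : M.Cfg) : Option M.Cfg :=
  match M.trans c.state (fun h => inputCell w (c.inputPos h))
      (fun t => c.work t (c.workPos t)) with
  | none => none
  | some (q, mv, act, o) =>
    some
      { state := q
        inputPos := fun h => min ((mv h).apply (c.inputPos h)) (w.length + 1)
        work := fun t => Function.update (c.work t) (c.workPos t) (act t).1
        workPos := fun t => (act t).2.apply (c.workPos t)
        out := c.out ++ o }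

/-- The configuration `c` occurs in the run of the machine on the input `w`. -/
def Machine.Reaches (M : Machine) (w : List Letter) (c : M.Cfg) : Prop :=
  Relation.ReflTransGen (fun c₁ c₂ => M.step w c₁ = some c₂) M.init c

/-- On the input `w`, the machine halts with the output `v`. -/
def Machine.Outputs (M : Machine) (w v : List Letter) : Prop :=
  ∃ c : M.Cfg, M.Reaches w c ∧ M.step w c = none ∧ c.out = v

/-- On the input `w`, the machine visits only the first `b` cells of each work tape. -/
def Machine.SpaceBoundedBy (M : Machine) (w : List Letter) (b : ℕ) : Prop :=
  ∀ c : M.Cfg, M.Reaches w c → ∀ t, c.workPos t < b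

/-- A function is logspace-computable, relative to an encoding of its arguments as words, if a
machine with space bound `O(log n)` computes the encoding of its value. -/
def LogspaceComputable {X : Type} (enc : X → List Letter) (f : X → Formula) : Prop :=
  ∃ (M : Machine) (c : ℕ), ∀ x : X,
    M.Outputs (enc x) (f x).encode ∧
      M.SpaceBoundedBy (enc x) (c * (Nat.log 2 (enc x).length + 1))

/-! ### Succinct definability of negations -/

/-- `NegationDefinable S enc atom bound`: each atom of the family `atom` is equivalent to the
negation of a `PL(S)`-formula of length `O(bound)`, and these formulas are logspace-computable
from the parameters. Where `bound` is zero, it is read as one. -/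
def NegationDefinable (S : Set Connective) {X : Type} (enc : X → List Letter) (atom : X → Atom)
    (bound : X → ℕ) : Prop :=
  ∃ (C : ℕ) (f : X → Formula),
    LogspaceComputable enc f ∧
      ∀ x : X, InPL S (f x) ∧ (atom x).EquivTo (Formula.snot (f x)) ∧
        (f x).length ≤ C * max (bound x) 1

/-- Two tuples. -/
abbrev TuplePair : Type := List PureFormula × List PureFormula

/-- Two tuples of equal length. -/
abbrev EqualTuplePair : Type := {x : TuplePair // x.1.length = x.2.length}

/-- Three tuples. -/
abbrev TupleTriple : Type := List PureFormula × List PureFormula × List PureFormula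

/-- A tuple and a single formula. -/
abbrev TupleFormula : Type := List PureFormula × PureFormula

def TuplePair.encode (x : TuplePair) : List Letter := encodeTuple x.1 ++ encodeTuple x.2

def EqualTuplePair.encode (x : EqualTuplePair) : List Letter :=
  encodeTuple x.1.1 ++ encodeTuple x.1.2

def TupleTriple.encode (x : TupleTriple) : List Letter :=
  encodeTuple x.1 ++ encodeTuple x.2.1 ++ encodeTuple x.2.2

def TupleFormula.encode (x : TupleFormula) : List Letter := encodeTuple x.1 ++ encodeTuple [x.2]

/-- The negation of the dependence atom is definable with length `O(|αβ|)`. -/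
def DependenceBound (S : Set Connective) : Prop :=
  NegationDefinable S TuplePair.encode (fun x => Atom.dep x.1 x.2)
    (fun x => tupleLength x.1 + tupleLength x.2)

/-- The negation of the exclusion atom is definable with length `O(n|αβ|)`. -/
def ExclusionBound (S : Set Connective) : Prop :=
  NegationDefinable S EqualTuplePair.encode (fun x => Atom.excl x.1.1 x.1.2)
    (fun x => x.1.1.length * (tupleLength x.1.1 + tupleLength x.1.2))

/-- The negation of the inclusion atom is definable with length `O(n|αβ|)`. -/
def InclusionBound (S : Set Connective) : Prop :=
  NegationDefinable S EqualTuplePair.encode (fun x => Atom.incl x.1.1 x.1.2)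
    (fun x => x.1.1.length * (tupleLength x.1.1 + tupleLength x.1.2))

/-- The negation of the conditional independence atom with the tuples `α`, `β` and the
condition `γ`, listed in this order, is definable with length `O(n(n+m+k)|αβγ|)`. -/
def IndependenceBound (S : Set Connective) : Prop :=
  NegationDefinable S TupleTriple.encode (fun x => Atom.indep x.1 x.2.2 x.2.1)
    (fun x => x.1.length * (x.1.length + x.2.1.length + x.2.2.length) *
      (tupleLength x.1 + tupleLength x.2.1 + tupleLength x.2.2))

/-- The negation of the unary anonymity atom is definable with length `O(n|β|+|α|)`, where an
empty tuple `α` counts as `n = 1`. -/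
def UnaryAnonymityBound (S : Set Connective) : Prop :=
  NegationDefinable S TupleFormula.encode (fun x => Atom.anon x.1 [x.2])
    (fun x => max x.1.length 1 * x.2.1.length + tupleLength x.1)

end TeamLogic

/-!
# Short formulas for negated atoms of dependency

The negation of an atom of dependency says that one or two assignments of the team are a
counterexample. A formula without unrestricted negation cannot name an assignment, but it can
single one out by a value: if `s` and `s'` differ on some tuple, then they differ on some entry `x`
of it, and after a Boolean disjunction over the entries and over the value `b` of `s` there, `s` and
`s'` are told apart by `x`. The literal `~⊥` gives "some assignment has the value `b` of `x`", and
since purely propositional formulas are flat, `¬x ∨ y` says "where `x` holds, so does `y`".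

* Dependence and exclusion fail because of two assignments, so it suffices to speak about a subteam,
  `⊤ ∨ …`, which is possible for strict splits as well.
* Inclusion, anonymity and independence fail because some assignment `s` differs on a tuple from
  every other assignment of a part of the team. The lax splitting disjunction of `separate` divides
  that part according to the index at which the tuples differ; `s` is singled out by a value and
  is put into each of the pieces, where its entries can be compared with those of the others.
  That every piece contains the same `s`, or at least one with the same values, is ensured by
  requiring constant values beforehand. The key facts are `exists_of_sat_separate` and
  `sat_separate_of_unique`.
* For independence, with `s` and `s'` as the counterexample, `s'` is singled out by an entry of `α`
  and separates all assignments that differ from it on `β` or `γ`; among the rest, `s` is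
  singled out by an entry of `β` and separates those that differ from it on `α`. Inside of the
  disjunction over the entries of `β`, the entry of `α` occurs only a constant number of times,
  which keeps the length within the bound.

The formulas are written as a `Template`: constants, signed copies of entries (an entry or its
dual), binary connectives, and folds over the indices of tuples. The instances of a template are
computed without any work tape by a machine with two input heads for each loop variable. For this,
templates are translated to programs for multi-head transducers (`Template.prog`,
`Template.eval_prog`), and programs to machines (`Prog.machine`, `Prog.Eval.outputs`).
-/

namespace TeamLogic

/-! ### Signed copies of purely propositional formulas -/

/-- The two splitting disjunctions. -/
def BinConn.IsSplitting (c : BinConn) : Prop := c = BinConn.split ∨ c = BinConn.strictSplit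

namespace Formula

/-- For a purely propositional formula `φ`, a formula that says that `φ` has the truth value `b`
under each assignment of the team: `φ` itself or its dual, with `sp` as splitting disjunction. -/
def signed (sp : BinConn) (b : Bool) : Formula → Formula
  | top => if b then top else bot
  | bot => if b then bot else top
  | var p => if b then var p else nvar p
  | nvar p => if b then nvar p else var p
  | snot φ => snot φ
  | bin c φ ψ =>
    bin (if c = BinConn.and ↔ b = true then BinConn.and else sp) (φ.signed sp b) (ψ.signed sp b)

/-- The truth value of a purely propositional formula under an assignment, by recursion. -/
def holdsAt {Φ : Finset ℕ} (s : Assignment Φ) : Formula → Bool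
  | top => true
  | bot => false
  | var p => s.get p
  | nvar p => !s.get p
  | snot φ => !φ.holdsAt s
  | bin BinConn.and φ ψ => φ.holdsAt s && ψ.holdsAt s
  | bin _ φ ψ => φ.holdsAt s || ψ.holdsAt s

theorem IsPure.conn {c : BinConn} {φ ψ : Formula} (h : (bin c φ ψ).IsPure) :
    (c = BinConn.and ∨ c = BinConn.split) ∧ φ.IsPure ∧ ψ.IsPure := by
  cases c <;> simp_all [IsPure]

end Formula

section

variable {Φ : Finset ℕ}

/-- For flat properties, both splitting disjunctions are pointwise disjunction. -/
theorem BinConn.IsSplitting.sem_flat {sp : BinConn} (hsp : sp.IsSplitting)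
    {P Q : Assignment Φ → Prop} {T : Team Φ} :
    sp.sem (fun T => ∀ s ∈ T, P s) (fun T => ∀ s ∈ T, Q s) T ↔ ∀ s ∈ T, P s ∨ Q s := by
  have hstrict : (∀ s ∈ T, P s ∨ Q s) →
      IsStrictSplit T {s ∈ T | P s} {s ∈ T | ¬ P s} ∧ ∀ s ∈ {s ∈ T | ¬ P s}, Q s := by
    intro h
    refine ⟨⟨⟨fun s hs => hs.1, fun s hs => hs.1, ?_⟩, ?_⟩,
      fun s hs => (h s hs.1).resolve_left hs.2⟩
    · ext s; simp only [Set.mem_union, Set.mem_ofPred_eq]; tauto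
    · ext s; simp only [Set.mem_inter_iff, Set.mem_ofPred_eq, Set.mem_empty_iff_false]; tauto
  have hsplit : ∀ S U : Team Φ, IsSplit T S U → (∀ s ∈ S, P s) → (∀ s ∈ U, Q s) →
      ∀ s ∈ T, P s ∨ Q s := by
    rintro S U ⟨-, -, rfl⟩ hS hU s (hs | hs)
    exacts [Or.inl (hS s hs), Or.inr (hU s hs)]
  rcases hsp with rfl | rfl
  · exact ⟨fun ⟨S, U, h, hS, hU⟩ => hsplit S U h hS hU,
      fun h => ⟨_, _, (hstrict h).1.1, fun s hs => hs.2, (hstrict h).2⟩⟩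
  · exact ⟨fun ⟨S, U, h, hS, hU⟩ => hsplit S U h.1 hS hU,
      fun h => ⟨_, _, (hstrict h).1, fun s hs => hs.2, (hstrict h).2⟩⟩

/-- With `⊤` on the left, both splitting disjunctions quantify over subteams. -/
theorem BinConn.IsSplitting.sem_top {sp : BinConn} (hsp : sp.IsSplitting)
    {A : Team Φ → Prop} {T : Team Φ} :
    sp.sem (fun _ => True) A T ↔ ∃ U ⊆ T, A U := by
  rcases hsp with rfl | rfl
  · exact ⟨fun ⟨S, U, h, _, hU⟩ => ⟨U, h.2.1, hU⟩,
      fun ⟨U, h, hU⟩ => ⟨T, U, ⟨subset_rfl, h, Set.union_eq_left.2 h⟩, trivial, hU⟩⟩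
  · exact ⟨fun ⟨S, U, h, _, hU⟩ => ⟨U, h.1.2.1, hU⟩,
      fun ⟨U, h, hU⟩ => ⟨T \ U, U, ⟨⟨Set.sdiff_subset, h, Set.sdiff_union_of_subset h⟩,
        Set.sdiff_inter_self⟩, trivial, hU⟩⟩

/-- A lax split with a flat left part may put any assignments into the right part that are
needed there, but must put those there that the left part does not admit. -/
theorem sem_split_flat_left {P : Assignment Φ → Prop} {A : Team Φ → Prop} {T : Team Φ} :
    BinConn.split.sem (fun T => ∀ s ∈ T, P s) A T ↔
      ∃ U ⊆ T, (∀ s ∈ T, s ∉ U → P s) ∧ A U := by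
  constructor
  · rintro ⟨S, U, ⟨-, hUT, rfl⟩, hS, hU⟩
    exact ⟨U, hUT, fun s hs hsU => hS s (hs.resolve_right hsU), hU⟩
  · rintro ⟨U, hUT, h, hU⟩
    exact ⟨T \ U, U, ⟨Set.sdiff_subset, hUT, Set.sdiff_union_of_subset hUT⟩,
      fun s hs => h s hs.1 hs.2, hU⟩

theorem Formula.sat_signed {sp : BinConn} (hsp : sp.IsSplitting) {φ : Formula} (hφ : φ.IsPure)
    (b : Bool) {T : Team Φ} : (φ.signed sp b).Sat T ↔ ∀ s ∈ T, φ.holdsAt s = b := by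
  induction φ generalizing T with
  | top => cases b <;> simp [signed, Sat, holdsAt, Set.eq_empty_iff_forall_notMem]
  | bot => cases b <;> simp [signed, Sat, holdsAt, Set.eq_empty_iff_forall_notMem]
  | var p => cases b <;> simp [signed, Sat, holdsAt]
  | nvar p => cases b <;> simp [signed, Sat, holdsAt]
  | snot => exact hφ.elim
  | bin c φ ψ ihφ ihψ =>
    obtain ⟨hc, hp, hq⟩ := hφ.conn
    have e₁ : (φ.signed sp b).Sat = fun T : Team Φ => ∀ s ∈ T, φ.holdsAt s = b :=
      funext fun T => propext (ihφ hp)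
    have e₂ : (ψ.signed sp b).Sat = fun T : Team Φ => ∀ s ∈ T, ψ.holdsAt s = b :=
      funext fun T => propext (ihψ hq)
    have hand (A B : Assignment Φ → Prop) (T : Team Φ) :
        BinConn.and.sem (fun T => ∀ s ∈ T, A s) (fun T => ∀ s ∈ T, B s) T ↔
          ∀ s ∈ T, A s ∧ B s := by
      simp only [BinConn.sem]
      exact forall₂_and.symm
    rcases hc with rfl | rfl <;> cases b <;>
      simp [signed, Sat, e₁, e₂, hand, hsp.sem_flat, holdsAt]
    exact forall₂_congr fun s _ => by cases φ.holdsAt s <;> simp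

theorem Formula.signed_split_true {φ : Formula} (hφ : φ.IsPure) :
    φ.signed BinConn.split true = φ := by
  induction φ with
  | snot => exact hφ.elim
  | bin c φ ψ ihφ ihψ =>
    obtain ⟨hc, hp, hq⟩ := hφ.conn
    rcases hc with rfl | rfl <;> simp [signed, ihφ hp, ihψ hq]
  | _ => rfl

theorem Assignment.value_eq_holdsAt (s : Assignment Φ) (α : PureFormula) :
    s.value α = α.1.holdsAt s := by
  have h := Formula.sat_signed (Φ := Φ) (Or.inl rfl) α.2 true (T := {s})
  rw [Formula.signed_split_true α.2] at h
  simp [value, h]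

theorem PureFormula.sat_signed {sp : BinConn} (hsp : sp.IsSplitting) (α : PureFormula) (b : Bool) :
    (α.1.signed sp b).Sat = fun T : Team Φ => ∀ s ∈ T, s.value α = b := by
  funext T
  simp only [Assignment.value_eq_holdsAt, Formula.sat_signed hsp α.2]

end

namespace Formula

theorem signed_inPL {S : Set Connective} {sp : BinConn} (hand : Connective.bin BinConn.and ∈ S)
    (hsp : Connective.bin sp ∈ S) {φ : Formula} (hφ : φ.IsPure) (b : Bool) :
    InPL S (φ.signed sp b) := by
  induction φ with
  | snot => exact hφ.elim
  | bin c φ ψ ihφ ihψ =>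
    obtain ⟨hc, hp, hq⟩ := hφ.conn
    refine InPL.bin ?_ (ihφ hp) (ihψ hq)
    split_ifs <;> assumption
  | _ => cases b <;> exact InPL.basic trivial

@[simp]
theorem length_bin (c : BinConn) (φ ψ : Formula) :
    (bin c φ ψ).length = φ.length + ψ.length + 3 := by
  simp [length, symbols]; omega

@[simp]
theorem length_snot (φ : Formula) : (snot φ).length = φ.length + 1 := by
  simp [length, symbols]

@[simp]
theorem length_top : top.length = 1 := rfl

@[simp]
theorem length_bot : bot.length = 1 := rfl

theorem one_le_length (φ : Formula) : 1 ≤ φ.length := by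
  cases φ <;> simp [length, symbols]

/-- A signed copy is at most twice as long, as it may have a negation sign in front of each
proposition. -/
theorem length_signed_le (sp : BinConn) (b : Bool) (φ : Formula) :
    (φ.signed sp b).length ≤ 2 * φ.length := by
  induction φ with
  | bin c φ ψ ihφ ihψ => simp only [signed, length_bin]; omega
  | snot φ => simp only [signed, length_snot]; omega
  | _ => cases b <;> simp [signed, length, symbols]

/-! ### Iterated binary connectives -/

/-- `((φ c ψ₀) c ψ₁) … c ψₙ₋₁`. -/
def fold (c : BinConn) (φ : Formula) (ψ : ℕ → Formula) : ℕ → Formula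
  | 0 => φ
  | n + 1 => bin c (fold c φ ψ n) (ψ n)

theorem fold_inPL {S : Set Connective} {c : BinConn} (hc : Connective.bin c ∈ S) {φ : Formula}
    {ψ : ℕ → Formula} (hφ : InPL S φ) (hψ : ∀ i, InPL S (ψ i)) (n : ℕ) :
    InPL S (fold c φ ψ n) := by
  induction n with
  | zero => exact hφ
  | succ n ih => exact InPL.bin hc ih (hψ n)

theorem length_fold (c : BinConn) (φ : Formula) (ψ : ℕ → Formula) (n : ℕ) :
    (fold c φ ψ n).length = φ.length + ∑ i ∈ Finset.range n, ((ψ i).length + 3) := by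
  induction n with
  | zero => simp [fold]
  | succ n ih => simp only [fold, length_bin, ih, Finset.sum_range_succ]; omega

variable {Φ : Finset ℕ} {T : Team Φ}

theorem sat_fold_and (φ : Formula) (ψ : ℕ → Formula) (n : ℕ) :
    (fold BinConn.and φ ψ n).Sat T ↔ φ.Sat T ∧ ∀ i < n, (ψ i).Sat T := by
  induction n with
  | zero => simp [fold]
  | succ n ih =>
    change (fold BinConn.and φ ψ n).Sat T ∧ _ ↔ _
    rw [ih, Nat.forall_lt_succ_right, and_assoc]

theorem sat_fold_bor (φ : Formula) (ψ : ℕ → Formula) (n : ℕ) :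
    (fold BinConn.bor φ ψ n).Sat T ↔ φ.Sat T ∨ ∃ i < n, (ψ i).Sat T := by
  induction n with
  | zero => simp [fold]
  | succ n ih =>
    change (fold BinConn.bor φ ψ n).Sat T ∨ _ ↔ _
    rw [ih, Nat.exists_lt_succ_right, or_assoc]

/-- An iterated lax splitting disjunction holds if the team is covered by teams for its
members. -/
theorem sat_fold_split (φ : Formula) (ψ : ℕ → Formula) (n : ℕ) :
    (fold BinConn.split φ ψ n).Sat T ↔
      ∃ (B : Team Φ) (U : ℕ → Team Φ), φ.Sat B ∧ B ⊆ T ∧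
        (∀ i < n, U i ⊆ T ∧ (ψ i).Sat (U i)) ∧ ∀ s ∈ T, s ∈ B ∨ ∃ i < n, s ∈ U i := by
  induction n generalizing T with
  | zero =>
    simp only [fold, Nat.not_lt_zero, false_and, exists_false, or_false, false_implies,
      implies_true, true_and]
    exact ⟨fun h => ⟨T, fun _ => ∅, h, subset_rfl, fun s hs => hs⟩,
      fun ⟨B, _, h, h₁, h₂⟩ => (Set.Subset.antisymm h₁ h₂) ▸ h⟩
  | succ n ih =>
    change (∃ S U, IsSplit T S U ∧ (fold BinConn.split φ ψ n).Sat S ∧ _) ↔ _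
    constructor
    · rintro ⟨S, V, ⟨hS, hV, rfl⟩, h, hψ⟩
      obtain ⟨B, U, hB, hBS, hU, hcov⟩ := ih.1 h
      refine ⟨B, fun i => if i = n then V else U i, hB, hBS.trans hS, ?_, ?_⟩
      · intro i hi
        by_cases h : i = n
        · subst h; simpa using hψ
        · simpa [h] using ⟨(hU i (by omega)).1.trans hS, (hU i (by omega)).2⟩
      · rintro s (hs | hs)
        · rcases hcov s hs with h | ⟨i, hi, h⟩
          · exact Or.inl h
          · exact Or.inr ⟨i, by omega, by simpa [show i ≠ n by omega] using h⟩
        · exact Or.inr ⟨n, by omega, by simpa using hs⟩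
    · rintro ⟨B, U, hB, hBT, hU, hcov⟩
      refine ⟨B ∪ ⋃ i < n, U i, U n, ⟨?_, (hU n (by omega)).1, ?_⟩, ?_, (hU n (by omega)).2⟩
      · exact Set.union_subset hBT (Set.iUnion₂_subset fun i hi => (hU i (by omega)).1)
      · refine Set.Subset.antisymm (Set.union_subset (Set.union_subset hBT
          (Set.iUnion₂_subset fun i hi => (hU i (by omega)).1)) (hU n (by omega)).1) ?_
        intro s hs
        rcases hcov s hs with h | ⟨i, hi, h⟩
        · exact Or.inl (Or.inl h)
        · rcases Nat.lt_succ_iff_lt_or_eq.1 hi with hi | rfl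
          · exact Or.inl (Or.inr (Set.mem_iUnion₂.2 ⟨i, hi, h⟩))
          · exact Or.inr h
      · refine ih.2 ⟨B, U, hB, Set.subset_union_left, fun i hi => ⟨?_, (hU i (by omega)).2⟩, ?_⟩
        · exact (Set.subset_iUnion₂ (s := fun i (_ : i < n) => U i) i hi).trans
            Set.subset_union_right
        · rintro s (hs | hs)
          · exact Or.inl hs
          · obtain ⟨i, hi, h⟩ := Set.mem_iUnion₂.1 hs
            exact Or.inr ⟨i, hi, h⟩

end Formula

/-! ### Programs for multi-head transducers -/

/-- Structured programs that control finitely many heads, indexed by `ι`, on a read-only input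
tape and append words to an output tape. Tests and emitted words depend on the scanned cells. -/
inductive Prog (ι : Type)
  | emit (o : (ι → InputCell) → List Letter)
  | move (h : ι) (m : Move)
  | seq (p q : Prog ι)
  | ite (b : (ι → InputCell) → Bool) (p q : Prog ι)
  | loop (b : (ι → InputCell) → Bool) (p : Prog ι)

/-- The cells scanned by heads at the given positions. -/
def scan {ι : Type} (w : List Letter) (pos : ι → ℕ) : ι → InputCell := fun h => inputCell w (pos h)

/-- The head positions after a simultaneous movement of all heads on the input `w`. -/
def advance {ι : Type} (w : List Letter) (mv : ι → Move) (pos : ι → ℕ) : ι → ℕ :=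
  fun h => min ((mv h).apply (pos h)) (w.length + 1)

namespace Prog

variable {ι : Type}

/-- The control points of a program. -/
def Point : Prog ι → Type
  | emit _ => Unit
  | move _ _ => Unit
  | seq p q => p.Point ⊕ q.Point
  | ite _ p q => Option (p.Point ⊕ q.Point)
  | loop _ p => Option p.Point

theorem finite_point : ∀ p : Prog ι, Finite p.Point
  | emit _ => inferInstanceAs (Finite Unit)
  | move _ _ => inferInstanceAs (Finite Unit)
  | seq p q =>
    have := p.finite_point
    have := q.finite_point
    inferInstanceAs (Finite (p.Point ⊕ q.Point))
  | ite _ p q =>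
    have := p.finite_point
    have := q.finite_point
    inferInstanceAs (Finite (Option (p.Point ⊕ q.Point)))
  | loop _ p =>
    have := p.finite_point
    inferInstanceAs (Finite (Option p.Point))

/-- The control point at which a program starts. -/
def entry : (p : Prog ι) → p.Point
  | emit _ => ()
  | move _ _ => ()
  | seq p _ => Sum.inl p.entry
  | ite _ _ _ => none
  | loop _ _ => none

/-- Small-step runs of a transition table, from the control point and head positions on the left
to those on the right. -/
inductive Path {Q : Type} (δ : Q → (ι → InputCell) → Option Q × (ι → Move) × List Letter)
    (w : List Letter) : Option Q → (ι → ℕ) → Option Q → (ι → ℕ) → List Letter → Prop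
  | refl (q : Option Q) (pos : ι → ℕ) : Path δ w q pos q pos []
  | step {q : Q} {pos pos' : ι → ℕ} {r : Option Q} {out : List Letter} :
      Path δ w (δ q (scan w pos)).1 (advance w (δ q (scan w pos)).2.1 pos) r pos' out →
        Path δ w (some q) pos r pos' ((δ q (scan w pos)).2.2 ++ out)

theorem Path.trans {Q : Type} {δ : Q → (ι → InputCell) → Option Q × (ι → Move) × List Letter}
    {w : List Letter} {q r t : Option Q} {pos pos' pos'' : ι → ℕ} {o o' : List Letter}
    (h : Path δ w q pos r pos' o) (h' : Path δ w r pos' t pos'' o') :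
    Path δ w q pos t pos'' (o ++ o') := by
  induction h with
  | refl => exact h'
  | step _ ih => rw [List.append_assoc]; exact Path.step (ih h')

/-- A run of a component of a program is a run of the program: `f` embeds the control points of
the component, and `e` is where the program continues when the component is left. -/
theorem Path.embed {Q R : Type} {δ : Q → (ι → InputCell) → Option Q × (ι → Move) × List Letter}
    {ε : R → (ι → InputCell) → Option R × (ι → Move) × List Letter} (f : Q → R) (e : Option R)
    (hf : ∀ q z, ε (f q) z = (((δ q z).1.elim e (some ∘ f)), (δ q z).2))
    {w : List Letter} {q r : Option Q} {pos pos' : ι → ℕ} {o : List Letter}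
    (h : Path δ w q pos r pos' o) :
    Path ε w (q.elim e (some ∘ f)) pos (r.elim e (some ∘ f)) pos' o := by
  induction h with
  | refl => exact Path.refl _ _
  | @step q pos pos' r out _ ih =>
    have key := Path.step (δ := ε) (w := w) (q := f q) (pos := pos) (r := r.elim e (some ∘ f))
      (pos' := pos') (out := out)
    rw [hf] at key
    exact key ih

theorem advance_stay {w : List Letter} {pos : ι → ℕ} (hp : ∀ h, pos h ≤ w.length + 1) :
    advance w (fun _ => Move.stay) pos = pos :=
  funext fun h => min_eq_left (hp h)

theorem Path.head {Q : Type} {δ : Q → (ι → InputCell) → Option Q × (ι → Move) × List Letter}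
    {w : List Letter} {q : Q} {q' r : Option Q} {mv : ι → Move} {o out out' : List Letter}
    {pos pos' : ι → ℕ} (h : δ q (scan w pos) = (q', mv, o))
    (hr : Path δ w q' (advance w mv pos) r pos' out) (ho : out' = o ++ out) :
    Path δ w (some q) pos r pos' out' := by
  have := Path.step (δ := δ) (w := w) (q := q) (pos := pos) (r := r) (pos' := pos') (out := out)
  rw [h] at this
  exact ho ▸ this hr

variable [DecidableEq ι]

/-- Big-step semantics: on the input `w`, the program takes the head positions `pos` to `pos'` and
emits `out`. -/
inductive Eval (w : List Letter) : Prog ι → (ι → ℕ) → (ι → ℕ) → List Letter → Prop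
  | emit (o : (ι → InputCell) → List Letter) (pos : ι → ℕ) :
      Eval w (emit o) pos pos (o (scan w pos))
  | move (h : ι) (m : Move) (pos : ι → ℕ) :
      Eval w (move h m) pos (Function.update pos h (min (m.apply (pos h)) (w.length + 1))) []
  | seq {p q : Prog ι} {pos pos₁ pos₂ : ι → ℕ} {o₁ o₂ : List Letter} :
      Eval w p pos pos₁ o₁ → Eval w q pos₁ pos₂ o₂ → Eval w (seq p q) pos pos₂ (o₁ ++ o₂)
  | ite_true {b : (ι → InputCell) → Bool} {p q : Prog ι} {pos pos' : ι → ℕ} {o : List Letter} :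
      b (scan w pos) = true → Eval w p pos pos' o → Eval w (ite b p q) pos pos' o
  | ite_false {b : (ι → InputCell) → Bool} {p q : Prog ι} {pos pos' : ι → ℕ} {o : List Letter} :
      b (scan w pos) = false → Eval w q pos pos' o → Eval w (ite b p q) pos pos' o
  | loop_done {b : (ι → InputCell) → Bool} {p : Prog ι} {pos : ι → ℕ} :
      b (scan w pos) = false → Eval w (loop b p) pos pos []
  | loop_step {b : (ι → InputCell) → Bool} {p : Prog ι} {pos pos₁ pos₂ : ι → ℕ}
      {o₁ o₂ : List Letter} :
      b (scan w pos) = true → Eval w p pos pos₁ o₁ → Eval w (loop b p) pos₁ pos₂ o₂ →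
        Eval w (loop b p) pos pos₂ (o₁ ++ o₂)

/-- The transition table of a program: the next control point (`none` when the program is left),
the head movements and the emitted word. -/
def next : (p : Prog ι) → p.Point → (ι → InputCell) → Option p.Point × (ι → Move) × List Letter
  | emit o => fun _ z => (none, fun _ => Move.stay, o z)
  | move h m => fun _ _ => (none, fun k => if k = h then m else Move.stay, [])
  | seq p q => fun x z =>
    match x with
    | Sum.inl x =>
      (some (((p.next x z).1.map Sum.inl).getD (Sum.inr q.entry)), (p.next x z).2)
    | Sum.inr x => ((q.next x z).1.map Sum.inr, (q.next x z).2)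
  | ite b p q => fun x z =>
    match x with
    | none =>
      (some (some (if b z then Sum.inl p.entry else Sum.inr q.entry)), fun _ => Move.stay, [])
    | some (Sum.inl x) => ((p.next x z).1.map (some ∘ Sum.inl), (p.next x z).2)
    | some (Sum.inr x) => ((q.next x z).1.map (some ∘ Sum.inr), (q.next x z).2)
  | loop b p => fun x z =>
    match x with
    | none => (if b z then some (some p.entry) else none, fun _ => Move.stay, [])
    | some x => (some (p.next x z).1, (p.next x z).2)

/-- The transition table of a program implements its big-step semantics. -/
theorem Eval.path {w : List Letter} {p : Prog ι} {pos pos' : ι → ℕ} {out : List Letter}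
    (he : Eval w p pos pos' out) (hp : ∀ h, pos h ≤ w.length + 1) :
    (∀ h, pos' h ≤ w.length + 1) ∧ Path p.next w (some p.entry) pos none pos' out := by
  induction he with
  | emit o pos =>
    exact ⟨hp, Path.head rfl (by rw [advance_stay hp]; exact Path.refl none _)
      (List.append_nil _).symm⟩
  | move h m pos =>
    have hadv : advance w (fun k => if k = h then m else Move.stay) pos =
        Function.update pos h (min (m.apply (pos h)) (w.length + 1)) := by
      funext k
      by_cases hk : k = h
      · subst hk; simp [advance]
      · simpa [advance, hk, Move.apply] using hp k
    exact ⟨fun k => hadv ▸ min_le_right _ _,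
      Path.head rfl (by rw [hadv]; exact Path.refl none _) rfl⟩
  | @seq p q _ _ _ _ _ _ _ ih₁ ih₂ =>
    obtain ⟨h₁, r₁⟩ := ih₁ hp
    obtain ⟨h₂, r₂⟩ := ih₂ h₁
    have e₁ := r₁.embed (ε := (p.seq q).next) Sum.inl (some (Sum.inr q.entry))
      (fun x z => by simp only [next]; cases (p.next x z).1 <;> rfl)
    have e₂ := r₂.embed (ε := (p.seq q).next) Sum.inr none
      (fun x z => by simp only [next]; cases (q.next x z).1 <;> rfl)
    exact ⟨h₂, e₁.trans e₂⟩
  | @ite_true b p q pos _ _ hb _ ih =>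
    obtain ⟨h₁, r₁⟩ := ih hp
    have e₁ := r₁.embed (ε := (ite b p q).next) (some ∘ Sum.inl) none
      (fun x z => by simp only [next, Function.comp]; cases (p.next x z).1 <;> rfl)
    exact ⟨h₁, Path.head (by simp only [next, entry, hb]; rfl)
      (by rw [advance_stay hp]; exact e₁) rfl⟩
  | @ite_false b p q pos _ _ hb _ ih =>
    obtain ⟨h₁, r₁⟩ := ih hp
    have e₁ := r₁.embed (ε := (ite b p q).next) (some ∘ Sum.inr) none
      (fun x z => by simp only [next, Function.comp]; cases (q.next x z).1 <;> rfl)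
    exact ⟨h₁, Path.head (by simp only [next, entry, hb]; rfl)
      (by rw [advance_stay hp]; exact e₁) rfl⟩
  | @loop_done b p pos hb =>
    exact ⟨hp, Path.head (by simp only [next, entry, hb]; rfl)
      (by rw [advance_stay hp]; exact Path.refl none pos) rfl⟩
  | @loop_step b p pos _ _ _ _ hb _ _ ih₁ ih₂ =>
    obtain ⟨h₁, r₁⟩ := ih₁ hp
    obtain ⟨h₂, r₂⟩ := ih₂ h₁
    have e₁ := r₁.embed (ε := (loop b p).next) some (some none)
      (fun x z => by simp only [next]; cases (p.next x z).1 <;> rfl)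
    exact ⟨h₂, Path.head (by simp only [next, entry, hb]; rfl)
      (by rw [advance_stay hp]; exact e₁.trans r₂) (List.nil_append _).symm⟩

/-- The machine without work tapes that runs a program and halts when the program is left. -/
noncomputable def machine [Fintype ι] (p : Prog ι) : Machine where
  State := Option p.Point
  finiteState := by
    have := p.finite_point
    infer_instance
  start := some p.entry
  Work := Unit
  finiteWork := inferInstance
  blank := ()
  inputHeads := Fintype.card ι
  workTapes := 0
  trans x z _ := x.map fun x =>
    let r := p.next x fun h => z (Fintype.equivFin ι h)
    (r.1, fun i => r.2.1 ((Fintype.equivFin ι).symm i), fun t => t.elim0, r.2.2)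

/-- The configurations of the machine that runs a program. -/
noncomputable def cfg [Fintype ι] (p : Prog ι) (x : Option p.Point) (pos : ι → ℕ)
    (out : List Letter) : p.machine.Cfg where
  state := x
  inputPos i := pos ((Fintype.equivFin ι).symm i)
  work t := t.elim0
  workPos t := t.elim0
  out := out

theorem step_cfg [Fintype ι] (p : Prog ι) (w : List Letter) (x : p.Point) (pos : ι → ℕ)
    (out : List Letter) :
    p.machine.step w (p.cfg (some x) pos out) =
      some (p.cfg (p.next x (scan w pos)).1 (advance w (p.next x (scan w pos)).2.1 pos)
        (out ++ (p.next x (scan w pos)).2.2)) := by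
  have hz : (fun h => inputCell w ((p.cfg (some x) pos out).inputPos (Fintype.equivFin ι h)))
      = scan w pos := by
    funext h
    simp [cfg, scan]
  simp only [Machine.step]
  simp only [machine, cfg, Option.map] at hz ⊢
  rw [hz]
  simp only [advance, Option.some.injEq]
  congr 1
  · exact funext fun t => Fin.elim0 t

theorem reaches_of_path [Fintype ι] {p : Prog ι} {w : List Letter} {q r : Option p.Point}
    {pos pos' : ι → ℕ} {o : List Letter} (h : Path p.next w q pos r pos' o) (out : List Letter) :
    Relation.ReflTransGen (fun c₁ c₂ => p.machine.step w c₁ = some c₂) (p.cfg q pos out)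
      (p.cfg r pos' (out ++ o)) := by
  induction h generalizing out with
  | refl => simpa using Relation.ReflTransGen.refl
  | step _ ih =>
    rw [← List.append_assoc]
    exact Relation.ReflTransGen.head (p.step_cfg w _ _ _) (ih _)

/-- A program that emits `out` gives a machine that outputs `out`. -/
theorem Eval.outputs [Fintype ι] {w : List Letter} {p : Prog ι} {pos : ι → ℕ} {out : List Letter}
    (he : Eval w p (fun _ => 0) pos out) : p.machine.Outputs w out := by
  have hr := reaches_of_path (he.path fun _ => Nat.zero_le _).2 []
  have hi : p.machine.init = p.cfg (some p.entry) (fun _ => 0) [] := by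
    simp only [Machine.init, cfg]
    congr 1
    · exact funext fun t => Fin.elim0 t
  exact ⟨p.cfg none pos out, by rw [Machine.Reaches, hi]; exact hr, rfl, rfl⟩

theorem spaceBoundedBy_machine [Fintype ι] (p : Prog ι) (w : List Letter) (b : ℕ) :
    p.machine.SpaceBoundedBy w b :=
  fun _ _ t => Fin.elim0 t

end Prog

/-! ### The layout of the input tape -/

theorem inputCell_append_cons (u : List Letter) (a : Letter) (v : List Letter) :
    inputCell (u ++ a :: v) (u.length + 1) = InputCell.letter a := by
  simp [inputCell]

theorem Formula.encode_bin (c : BinConn) (φ ψ : Formula) :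
    (bin c φ ψ).encode =
      [Letter.lpar] ++ (φ.encode ++ ([Letter.bin c] ++ (ψ.encode ++ [Letter.rpar]))) := by
  simp [encode, symbols, Symbol.encode]

theorem Formula.not_mem_encode {a : Letter} (ha : a = Letter.comma ∨ a = Letter.semicolon)
    (φ : Formula) : a ∉ φ.encode := by
  simp only [encode, List.mem_flatMap, not_exists, not_and]
  intro s _
  rcases ha with rfl | rfl <;> cases s <;> simp [Symbol.encode]

/-- An entry of a tuple on the tape, together with the comma that follows it. -/
def entryWord (φ : PureFormula) : List Letter := φ.1.encode ++ [Letter.comma]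

theorem semicolon_notMem_entryWord (φ : PureFormula) : Letter.semicolon ∉ entryWord φ := by
  simp [entryWord, Formula.not_mem_encode]

theorem encodeTuple_eq (α : List PureFormula) :
    encodeTuple α = α.flatMap entryWord ++ [Letter.semicolon] := rfl

/-- The number of letters before the `k`-th tuple on the tape. -/
def tuplePos (Ts : List (List PureFormula)) (k : ℕ) : ℕ := ((Ts.take k).flatMap encodeTuple).length

/-- The position of the `i`-th entry of the `k`-th tuple on the tape; if `i` is the number of
entries, the position of the semicolon after the tuple. The left end marker has position `0`. -/
def entryPos (Ts : List (List PureFormula)) (k i : ℕ) : ℕ :=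
  tuplePos Ts k + (((Ts.getD k []).take i).flatMap entryWord).length + 1

/-- The tape around the `k`-th tuple. -/
theorem tape_tuple {Ts : List (List PureFormula)} {k : ℕ} (hk : k < Ts.length) :
    ∃ u y, Ts.flatMap encodeTuple =
        u ++ (Ts.getD k []).flatMap entryWord ++ Letter.semicolon :: y ∧
      tuplePos Ts k = u.length ∧ (u = [] ∨ ∃ u', u = u' ++ [Letter.semicolon]) := by
  refine ⟨(Ts.take k).flatMap encodeTuple, (Ts.drop (k + 1)).flatMap encodeTuple, ?_, rfl, ?_⟩
  · have h : Ts = Ts.take k ++ Ts.getD k [] :: Ts.drop (k + 1) := by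
      simp [List.getD_eq_getElem?_getD, hk]
    conv_lhs => rw [h]
    simp [encodeTuple_eq]
  · rcases k with _ | k
    · simp
    · right
      rw [List.take_succ_eq_append_getElem (by omega)]
      simp only [List.flatMap_append, List.flatMap_singleton, encodeTuple_eq]
      exact ⟨_, (List.append_assoc _ _ _).symm⟩

/-- The tape around the `i`-th entry of the `k`-th tuple. -/
theorem tape_entry {Ts : List (List PureFormula)} {k i : ℕ} (hk : k < Ts.length)
    (hi : i < (Ts.getD k []).length) :
    ∃ u y, Ts.flatMap encodeTuple =
        u ++ ((Ts.getD k [])[i]).1.encode ++ Letter.comma :: y ∧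
      entryPos Ts k i = u.length + 1 ∧
      entryPos Ts k (i + 1) = u.length + ((Ts.getD k [])[i]).1.encode.length + 2 ∧
      (u = [] ∨ ∃ u' a, u = u' ++ [a] ∧ (a = Letter.comma ∨ a = Letter.semicolon)) := by
  obtain ⟨u, y, hw, hu, hlast⟩ := tape_tuple hk
  simp only [entryPos, hu]
  rw [hw]
  generalize Ts.getD k [] = α at hi ⊢
  refine ⟨u ++ (α.take i).flatMap entryWord,
    (α.drop (i + 1)).flatMap entryWord ++ Letter.semicolon :: y, ?_, ?_, ?_, ?_⟩
  · have h : α = α.take i ++ α[i] :: α.drop (i + 1) := by simp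
    conv_lhs => rw [h]
    rw [List.flatMap_append, List.flatMap_cons, entryWord]
    simp only [List.append_assoc, List.cons_append, List.nil_append]
  · simp
  · rw [List.take_succ_eq_append_getElem hi]
    simp only [List.flatMap_append, List.flatMap_singleton, entryWord, List.length_append,
      List.length_singleton]
    omega
  · rcases i with _ | i
    · simp only [List.take_zero, List.flatMap_nil, List.append_nil]
      rcases hlast with h | ⟨u', h⟩
      exacts [Or.inl h, Or.inr ⟨u', _, h, Or.inr rfl⟩]
    · right
      rw [List.take_succ_eq_append_getElem (by omega)]
      simp only [List.flatMap_append, List.flatMap_singleton]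
      exact ⟨u ++ ((α.take i).flatMap entryWord ++ α[i].1.encode), Letter.comma,
        by simp [entryWord], Or.inl rfl⟩

theorem entryPos_zero (Ts : List (List PureFormula)) (k : ℕ) :
    entryPos Ts k 0 = tuplePos Ts k + 1 := by
  simp [entryPos]

theorem entryPos_length (Ts : List (List PureFormula)) (k : ℕ) :
    entryPos Ts k (Ts.getD k []).length =
      tuplePos Ts k + ((Ts.getD k []).flatMap entryWord).length + 1 := by
  rw [entryPos, List.take_length]

theorem tuplePos_succ {Ts : List (List PureFormula)} {k : ℕ} (hk : k < Ts.length) :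
    tuplePos Ts (k + 1) = tuplePos Ts k + ((Ts.getD k []).flatMap entryWord).length + 1 := by
  rw [tuplePos, List.take_succ_eq_append_getElem hk]
  simp [tuplePos, encodeTuple_eq, List.getD_eq_getElem?_getD, hk, add_assoc]

/-! ### Moving heads between tuples and entries -/

namespace Prog

variable {ι : Type} [DecidableEq ι] {w : List Letter} {h : ι} {pos : ι → ℕ}

/-- Move the head `h` as long as the scanned cell satisfies `b`. -/
def seek (h : ι) (m : Move) (b : InputCell → Bool) : Prog ι :=
  loop (fun z => b (z h)) (move h m)


theorem eval_seek_right {b : InputCell → Bool} {u v y : List Letter} (hw : w = u ++ v ++ y)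
    (hv : ∀ a ∈ v, b (InputCell.letter a) = true)
    (hy : b (inputCell w (u.length + v.length + 1)) = false) (hpos : pos h = u.length + 1) :
    Eval w (seek h Move.right b) pos (Function.update pos h (u.length + v.length + 1)) [] := by
  induction v generalizing u pos with
  | nil =>
    have : Function.update pos h (u.length + ([] : List Letter).length + 1) = pos := by
      simp [← hpos]
    rw [this]
    exact Eval.loop_done (by simpa [scan, hpos] using hy)
  | cons a v ih =>
    have hw' : w = (u ++ [a]) ++ v ++ y := by simp [hw]
    have hc : inputCell w (u.length + 1) = InputCell.letter a := by
      rw [hw, List.append_assoc]; exact inputCell_append_cons _ _ _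
    have hmove : Function.update pos h (min (Move.right.apply (pos h)) (w.length + 1)) =
        Function.update pos h ((u ++ [a]).length + 1) := by
      rw [hpos, min_eq_left]
      · simp [Move.apply]
      · simp [Move.apply, hw]
    have hrec := ih hw' (fun a ha => hv a (List.mem_cons_of_mem _ ha))
      (by rw [← hy]; simp; congr 2; omega)
      (pos := Function.update pos h ((u ++ [a]).length + 1)) (by simp)
    rw [← hmove] at hrec
    have := Eval.loop_step (b := fun z => b (z h)) (w := w) (pos := pos)
      (by simp only [scan, hpos, hc]; exact hv a List.mem_cons_self)
      (Eval.move h Move.right pos) hrec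
    simpa [seek, add_assoc, add_comm 1] using this

theorem eval_seek_left {b : InputCell → Bool} {u v y : List Letter} (hw : w = u ++ v ++ y)
    (hv : ∀ a ∈ v, b (InputCell.letter a) = true)
    (hu : b (inputCell w u.length) = false) (hpos : pos h = u.length + v.length) :
    Eval w (seek h Move.left b) pos (Function.update pos h u.length) [] := by
  induction v using List.reverseRecOn generalizing y pos with
  | nil =>
    have hpos' : pos h = u.length := by simpa using hpos
    have : Function.update pos h u.length = pos := by simp [← hpos']
    rw [this]
    exact Eval.loop_done (by simpa [scan, hpos'] using hu)
  | append_singleton v a ih =>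
    have hw' : w = u ++ v ++ a :: y := by simp [hw]
    have hpos' : pos h = (u ++ v).length + 1 := by simp [hpos, add_assoc]
    have hc : inputCell w (pos h) = InputCell.letter a := by
      rw [hpos', hw']; exact inputCell_append_cons _ _ _
    have hmove : Function.update pos h (min (Move.left.apply (pos h)) (w.length + 1)) =
        Function.update pos h (u.length + v.length) := by
      rw [hpos', min_eq_left]
      · simp [Move.apply]
      · simp [Move.apply, hw']
        omega
    have hrec := ih hw' (fun a ha => hv a (List.mem_append_left _ ha))
      (pos := Function.update pos h (u.length + v.length)) (by simp)
    rw [← hmove] at hrec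
    have := Eval.loop_step (b := fun z => b (z h)) (w := w) (pos := pos)
      (by simp only [scan, hc]; exact hv a (by simp)) (Eval.move h Move.left pos) hrec
    simpa [seek] using this

/-- The scanned cell holds none of the letters in `l` and is not the left end marker. -/
def avoids (l : List Letter) : InputCell → Bool
  | InputCell.leftEnd => false
  | InputCell.letter a => a ∉ l
  | InputCell.rightEnd => true

/-- Move the head `h` to the right until it has passed the next letter `a`. -/
def pass (h : ι) (a : Letter) : Prog ι := seq (seek h Move.right (avoids [a])) (move h Move.right)

/-- Move the head `h` to the left, by at least one cell, to the first cell after a letter in `l`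
or after the left end marker. -/
def backTo (h : ι) (l : List Letter) : Prog ι :=
  seq (move h Move.left) (seq (seek h Move.left (avoids l)) (move h Move.right))

theorem eval_pass {a : Letter} {u v y : List Letter} (hw : w = u ++ v ++ a :: y) (hv : a ∉ v)
    (hpos : pos h = u.length + 1) :
    Eval w (pass h a) pos (Function.update pos h (u.length + v.length + 2)) [] := by
  have hc : inputCell w (u.length + v.length + 1) = InputCell.letter a := by
    rw [hw, ← List.length_append]; exact inputCell_append_cons _ _ _
  have e₁ := eval_seek_right (h := h) (b := avoids [a]) hw
    (fun x hx => by simpa [avoids] using fun e : x = a => hv (e ▸ hx))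
    (by rw [hc]; simp [avoids]) hpos
  have e₂ := Eval.move (w := w) h Move.right (Function.update pos h (u.length + v.length + 1))
  have := Eval.seq e₁ e₂
  rw [Function.update_self, Function.update_idem, min_eq_left] at this
  · exact this
  · simp [Move.apply, hw]

theorem eval_backTo {l : List Letter} {u v y : List Letter} (hw : w = u ++ v ++ y)
    (hv : ∀ a ∈ v, a ∉ l) (hu : u = [] ∨ ∃ u' a, u = u' ++ [a] ∧ a ∈ l)
    (hpos : pos h = u.length + v.length + 1) :
    Eval w (backTo h l) pos (Function.update pos h (u.length + 1)) [] := by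
  have hc : avoids l (inputCell w u.length) = false := by
    rcases hu with rfl | ⟨u', a, rfl, ha⟩
    · rfl
    · have : w = u' ++ a :: (v ++ y) := by simp [hw]
      rw [List.length_append, List.length_singleton, this, inputCell_append_cons]
      simpa [avoids] using ha
  have hlen : w.length = u.length + v.length + y.length := by simp [hw, add_assoc]
  have e₁ := Eval.move (w := w) h Move.left pos
  rw [hpos, min_eq_left (by simp [Move.apply]; omega)] at e₁
  have e₂ := eval_seek_left (h := h) (b := avoids l) hw
    (fun x hx => by simpa [avoids] using hv x hx) hc
    (pos := Function.update pos h (Move.left.apply (u.length + v.length + 1)))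
    (by simp [Move.apply])
  have e₃ := Eval.move (w := w) h Move.right (Function.update pos h u.length)
  rw [Function.update_self, Function.update_idem,
    min_eq_left (by simp [Move.apply]; omega)] at e₃
  rw [Function.update_idem] at e₂
  exact Eval.seq e₁ (Eval.seq e₂ e₃)

/-! ### Copying an entry -/

/-- The word that replaces a letter in a signed copy of a formula; negation signs are treated
separately. -/
def signedLetter (sp : BinConn) (b : Bool) : InputCell → List Letter
  | InputCell.letter Letter.top => [if b then Letter.top else Letter.bot]
  | InputCell.letter Letter.bot => [if b then Letter.bot else Letter.top]
  | InputCell.letter Letter.prop => if b then [Letter.prop] else [Letter.neg, Letter.prop]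
  | InputCell.letter (Letter.bin c) =>
    [Letter.bin (if c = BinConn.and ↔ b = true then BinConn.and else sp)]
  | InputCell.letter a => [a]
  | _ => []

/-- Emit the signed copy of the entry at which the head `h` stands, up to the comma. A negation
sign is followed by a proposition and is treated together with its marker. -/
def copyLoop (sp : BinConn) (b : Bool) (h : ι) : Prog ι :=
  loop (fun z => z h ≠ InputCell.letter Letter.comma)
    (ite (fun z => z h = InputCell.letter Letter.neg)
      (seq (move h Move.right)
        (seq (emit fun _ => if b then [Letter.neg, Letter.prop] else [Letter.prop])
          (move h Move.right)))
      (seq (emit fun z => signedLetter sp b (z h)) (move h Move.right)))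

/-- Emit the signed copy of the entry at which the head `h` stands, and return to its start. -/
def copy (sp : BinConn) (b : Bool) (h : ι) : Prog ι :=
  seq (copyLoop sp b h) (backTo h [Letter.comma, Letter.semicolon])

/-- Wherever the head `h` stands at the start of the word `u`, the copying loop passes over `u`
and emits `v`. -/
def Copies (w : List Letter) (sp : BinConn) (b : Bool) (h : ι) (u v : List Letter) : Prop :=
  ∀ (x y : List Letter) (pos pos' : ι → ℕ) (o : List Letter), w = x ++ u ++ y →
    pos h = x.length + 1 →
    Eval w (copyLoop sp b h) (Function.update pos h (x.length + u.length + 1)) pos' o →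
    Eval w (copyLoop sp b h) pos pos' (v ++ o)

variable {sp : BinConn} {b : Bool}

theorem Copies.append {u u' v v' : List Letter} (hu : Copies w sp b h u v)
    (hu' : Copies w sp b h u' v') : Copies w sp b h (u ++ u') (v ++ v') := by
  intro x y pos pos' o hw hpos he
  rw [List.append_assoc]
  refine hu x (u' ++ y) pos pos' _ (by simp [hw]) hpos ?_
  refine hu' (x ++ u) y _ pos' o (by simp [hw]) (by simp) ?_
  simpa [add_assoc] using he

theorem Copies.nil : Copies w sp b h [] [] := by
  intro x y pos pos' o hw hpos he
  have : Function.update pos h (x.length + ([] : List Letter).length + 1) = pos := by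
    simp [← hpos]
  rwa [this] at he

theorem copies_letter {a : Letter} (hc : a ≠ Letter.comma) (hn : a ≠ Letter.neg) :
    Copies w sp b h [a] (signedLetter sp b (InputCell.letter a)) := by
  intro x y pos pos' o hw hpos he
  have hcell : scan w pos h = InputCell.letter a := by
    rw [scan, hpos, hw, List.append_assoc]; exact inputCell_append_cons _ _ _
  have e₁ := Eval.emit (w := w) (fun z => signedLetter sp b (z h)) pos
  have e₂ := Eval.move (w := w) h Move.right pos
  rw [hpos, min_eq_left (by simp [Move.apply, hw])] at e₂
  have := Eval.loop_step (b := fun z => decide (z h ≠ InputCell.letter Letter.comma))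
    (by simp [hcell, hc])
    (Eval.ite_false (b := fun z => decide (z h = InputCell.letter Letter.neg))
      (by simp [hcell, hn]) (Eval.seq e₁ e₂)) he
  rw [List.append_nil, hcell] at this
  exact this

theorem copies_neg :
    Copies w sp b h [Letter.neg, Letter.prop]
      (if b then [Letter.neg, Letter.prop] else [Letter.prop]) := by
  intro x y pos pos' o hw hpos he
  have hcell : scan w pos h = InputCell.letter Letter.neg := by
    rw [scan, hpos, hw, List.append_assoc]; exact inputCell_append_cons _ _ _
  have e₁ := Eval.move (w := w) h Move.right pos
  rw [hpos, min_eq_left (by simp [Move.apply, hw])] at e₁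
  have e₂ := Eval.emit (w := w) (fun _ => if b then [Letter.neg, Letter.prop] else [Letter.prop])
    (Function.update pos h (Move.right.apply (x.length + 1)))
  have e₃ := Eval.move (w := w) h Move.right
    (Function.update pos h (Move.right.apply (x.length + 1)))
  rw [Function.update_self, Function.update_idem,
    min_eq_left (by simp [Move.apply, hw])] at e₃
  have := Eval.loop_step (b := fun z => decide (z h ≠ InputCell.letter Letter.comma))
    (by simp [hcell])
    (Eval.ite_true (b := fun z => decide (z h = InputCell.letter Letter.neg))
      (by simp [hcell]) (Eval.seq e₁ (Eval.seq e₂ e₃))) he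
  rw [List.append_nil, List.nil_append] at this
  exact this

theorem copies_bits (p : ℕ) :
    Copies w sp b h ((Nat.bits p).map Letter.bit) ((Nat.bits p).map Letter.bit) := by
  induction Nat.bits p with
  | nil => exact Copies.nil
  | cons d l ih => exact (copies_letter (a := Letter.bit d) (by simp) (by simp)).append ih

theorem copies_formula {φ : Formula} (hφ : φ.IsPure) :
    Copies w sp b h φ.encode (φ.signed sp b).encode := by
  induction φ with
  | snot => exact hφ.elim
  | top =>
    have := copies_letter (w := w) (sp := sp) (b := b) (h := h) (a := Letter.top) (by simp)
      (by simp)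
    cases b <;> exact this
  | bot =>
    have := copies_letter (w := w) (sp := sp) (b := b) (h := h) (a := Letter.bot) (by simp)
      (by simp)
    cases b <;> exact this
  | var p =>
    have := (copies_letter (w := w) (sp := sp) (b := b) (h := h) (a := Letter.prop) (by simp)
      (by simp)).append (copies_bits p)
    cases b <;>
      simpa [Formula.encode, Formula.signed, Formula.symbols, Symbol.encode, signedLetter]
        using this
  | nvar p =>
    have := (copies_neg (w := w) (sp := sp) (b := b) (h := h)).append (copies_bits p)
    cases b <;>
      simpa [Formula.encode, Formula.signed, Formula.symbols, Symbol.encode, signedLetter]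
        using this
  | bin c φ ψ ihφ ihψ =>
    obtain ⟨-, hp, hq⟩ := hφ.conn
    simp only [Formula.signed, Formula.encode_bin]
    exact (copies_letter (a := Letter.lpar) (by simp) (by simp)).append ((ihφ hp).append
      ((copies_letter (a := Letter.bin c) (by simp) (by simp)).append ((ihψ hq).append
        (copies_letter (a := Letter.rpar) (by simp) (by simp)))))

/-! ### Copying and moving on a tape with tuples -/

variable {Ts : List (List PureFormula)} {k i : ℕ}

theorem eval_copy (hk : k < Ts.length) (hi : i < (Ts.getD k []).length)
    (hpos : pos h = entryPos Ts k i) :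
    Eval (Ts.flatMap encodeTuple) (copy sp b h) pos pos
      (((Ts.getD k [])[i]).1.signed sp b).encode := by
  obtain ⟨u, y, hw, hu, -, hlast⟩ := tape_entry hk hi
  generalize (Ts.getD k [])[i] = φ at hw ⊢
  rw [hu] at hpos
  have hcell : inputCell (Ts.flatMap encodeTuple) (u.length + φ.1.encode.length + 1) =
      InputCell.letter Letter.comma := by
    rw [hw, ← List.length_append]; exact inputCell_append_cons _ _ _
  have e₁ := copies_formula (sp := sp) (b := b) (h := h) φ.2 u (Letter.comma :: y) pos _ [] hw hpos
    (Eval.loop_done (by simp [scan, hcell]))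
  have e₂ := eval_backTo (h := h) (l := [Letter.comma, Letter.semicolon]) hw
    (fun a ha hl => Formula.not_mem_encode (by simpa using hl) _ ha) (by simpa using hlast)
    (pos := Function.update pos h (u.length + φ.1.encode.length + 1)) (by simp)
  have := Eval.seq e₁ e₂
  rw [Function.update_idem, ← hpos, Function.update_eq_self, List.append_nil,
    List.append_nil] at this
  exact this

theorem eval_pass_comma (hk : k < Ts.length) (hi : i < (Ts.getD k []).length)
    (hpos : pos h = entryPos Ts k i) :
    Eval (Ts.flatMap encodeTuple) (pass h Letter.comma) pos
      (Function.update pos h (entryPos Ts k (i + 1))) [] := by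
  obtain ⟨u, y, hw, hu, hu', -⟩ := tape_entry hk hi
  rw [hu']
  exact eval_pass hw (Formula.not_mem_encode (Or.inl rfl) _) (hpos.trans hu)

theorem semicolon_notMem_flatMap (α : List PureFormula) :
    Letter.semicolon ∉ α.flatMap entryWord := by
  simp [semicolon_notMem_entryWord]

theorem eval_backTo_semicolon (hk : k < Ts.length)
    (hpos : pos h = entryPos Ts k (Ts.getD k []).length) :
    Eval (Ts.flatMap encodeTuple) (backTo h [Letter.semicolon]) pos
      (Function.update pos h (entryPos Ts k 0)) [] := by
  obtain ⟨u, y, hw, hu, hlast⟩ := tape_tuple hk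
  rw [entryPos_length, hu] at hpos
  rw [entryPos_zero, hu]
  refine eval_backTo hw (fun a ha hl => ?_) ?_ hpos
  · rw [List.mem_singleton.1 hl] at ha
    exact semicolon_notMem_flatMap _ ha
  · simpa using hlast

theorem eval_pass_semicolon (hk : k < Ts.length) (hpos : pos h = entryPos Ts k 0) :
    Eval (Ts.flatMap encodeTuple) (pass h Letter.semicolon) pos
      (Function.update pos h (entryPos Ts (k + 1) 0)) [] := by
  obtain ⟨u, y, hw, hu, -⟩ := tape_tuple hk
  rw [entryPos_zero, hu] at hpos
  rw [entryPos_zero, tuplePos_succ hk, hu]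
  exact eval_pass hw (semicolon_notMem_flatMap _) hpos

theorem inputCell_entryPos_length (hk : k < Ts.length) :
    inputCell (Ts.flatMap encodeTuple) (entryPos Ts k (Ts.getD k []).length) =
      InputCell.letter Letter.semicolon := by
  obtain ⟨u, y, hw, hu, -⟩ := tape_tuple hk
  rw [entryPos_length, hu, hw, ← List.length_append]
  exact inputCell_append_cons _ _ _

theorem inputCell_entryPos_ne (hk : k < Ts.length) (hi : i < (Ts.getD k []).length) :
    inputCell (Ts.flatMap encodeTuple) (entryPos Ts k i) ≠ InputCell.letter Letter.semicolon := by
  obtain ⟨u, y, hw, hu, -⟩ := tape_entry hk hi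
  obtain ⟨a, v, hv, ha⟩ : ∃ a v, ((Ts.getD k [])[i]).1.encode ++ Letter.comma :: y = a :: v ∧
      a ≠ Letter.semicolon := by
    have hn := Formula.not_mem_encode (a := Letter.semicolon) (Or.inr rfl) (Ts.getD k [])[i].1
    cases hφ : (Ts.getD k [])[i].1.encode with
    | nil => exact ⟨_, _, rfl, by simp⟩
    | cons a v => exact ⟨_, _, rfl, fun e => hn (by rw [hφ, e]; exact List.mem_cons_self)⟩
  rw [hu, hw, List.append_assoc, hv, inputCell_append_cons]
  simpa using ha

/-- Move the head `h` from the left end marker to the start of the `k`-th tuple. -/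
def goto (h : ι) : ℕ → Prog ι
  | 0 => move h Move.right
  | k + 1 => seq (goto h k) (pass h Letter.semicolon)

theorem eval_goto (hk : k < Ts.length) (hpos : pos h = 0) :
    Eval (Ts.flatMap encodeTuple) (goto h k) pos (Function.update pos h (entryPos Ts k 0)) [] := by
  induction k with
  | zero =>
    have := Eval.move (w := Ts.flatMap encodeTuple) h Move.right pos
    rw [hpos, min_eq_left (by simp [Move.apply])] at this
    simpa [goto, entryPos_zero, tuplePos, Move.apply] using this
  | succ k ih =>
    have := Eval.seq (ih (by omega)) (eval_pass_semicolon (h := h) (k := k) (by omega)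
      (pos := Function.update pos h (entryPos Ts k 0)) (by simp))
    simpa [goto] using this

/-- Move each head of a list from the left end marker to the start of the tuple assigned to it. -/
def gotoAll (τ : ι → ℕ) : List ι → Prog ι
  | [] => emit fun _ => []
  | h :: l => seq (goto h (τ h)) (gotoAll τ l)

theorem eval_gotoAll {τ : ι → ℕ} (hτ : ∀ h, τ h < Ts.length) (l : List ι) (hl : l.Nodup)
    (hpos : ∀ h ∈ l, pos h = 0) :
    Eval (Ts.flatMap encodeTuple) (gotoAll τ l) pos
      (fun h => if h ∈ l then entryPos Ts (τ h) 0 else pos h) [] := by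
  induction l generalizing pos with
  | nil => simpa [gotoAll] using Eval.emit (w := Ts.flatMap encodeTuple) (fun _ => []) pos
  | cons h l ih =>
    have hn := List.nodup_cons.1 hl
    have e₁ := eval_goto (h := h) (hτ h) (hpos h List.mem_cons_self)
    have e₂ := ih hn.2 (pos := Function.update pos h (entryPos Ts (τ h) 0)) fun k hk => by
      rw [Function.update_of_ne (ne_of_mem_of_not_mem hk hn.1)]
      exact hpos k (List.mem_cons_of_mem _ hk)
    have e := Eval.seq e₁ e₂
    have hfun : (fun k => if k ∈ l then entryPos Ts (τ k) 0
        else Function.update pos h (entryPos Ts (τ h) 0) k) =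
        fun k => if k ∈ h :: l then entryPos Ts (τ k) 0 else pos k := by
      funext k
      by_cases hk : k = h
      · subst hk; simp
      · simp [hk]
    rw [hfun] at e
    exact e

end Prog

/-! ### Formula templates -/

/-- Descriptions of formulas that depend on tuples. A loop variable `v : V` runs through the
indices of two tuples of equal length at the same time; `(v, false)` and `(v, true)` stand for the
entries of these tuples at the current index. A single tuple is treated by taking it twice. -/
inductive Template (V : Type)
  | const (φ : Formula)
  | entry (x : V × Bool) (b : Bool)
  | bin (c : BinConn) (s t : Template V)
  | fold (c : BinConn) (v : V) (s t : Template V)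

namespace Template

variable {V : Type} [DecidableEq V]

/-- The entry denoted by `x` if `A` assigns the tuples and `ρ` the current indices. -/
def entryAt (A : V × Bool → List PureFormula) (ρ : V → ℕ) (x : V × Bool) : PureFormula :=
  (A x)[ρ x.1]?.getD ⟨Formula.top, trivial⟩

/-- The formula described by a template. An `entry` becomes a signed copy of an entry of a tuple,
with `sp` as splitting disjunction. -/
def inst (sp : BinConn) (A : V × Bool → List PureFormula) : Template V → (V → ℕ) → Formula
  | const φ, _ => φ
  | entry x b, ρ => (entryAt A ρ x).1.signed sp b
  | bin c s t, ρ => Formula.bin c (s.inst sp A ρ) (t.inst sp A ρ)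
  | fold c v s t, ρ =>
    Formula.fold c (s.inst sp A ρ) (fun i => t.inst sp A (Function.update ρ v i))
      (A (v, false)).length

/-- All variables of the template are bound by loops, apart from those in `B`, and no variable
is bound inside of its own scope. -/
def WellScoped : Template V → Finset V → Prop
  | const _, _ => True
  | entry x _, B => x.1 ∈ B
  | bin _ s t, B => s.WellScoped B ∧ t.WellScoped B
  | fold _ v s t, B => v ∉ B ∧ s.WellScoped B ∧ t.WellScoped (insert v B)

/-- Instances of the template are built with connectives in `S`. -/
def Over (S : Set Connective) : Template V → Prop
  | const φ => InPL S φ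
  | entry _ _ => True
  | bin c s t => Connective.bin c ∈ S ∧ s.Over S ∧ t.Over S
  | fold c _ s t => Connective.bin c ∈ S ∧ s.Over S ∧ t.Over S

theorem inst_inPL {S : Set Connective} {sp : BinConn} (hand : Connective.bin BinConn.and ∈ S)
    (hsp : Connective.bin sp ∈ S) (A : V × Bool → List PureFormula) {t : Template V}
    (ht : t.Over S) (ρ : V → ℕ) : InPL S (t.inst sp A ρ) := by
  induction t generalizing ρ with
  | const φ => exact ht
  | entry x b => exact Formula.signed_inPL hand hsp (entryAt A ρ x).2 b
  | bin c s t ihs iht => exact InPL.bin ht.1 (ihs ht.2.1 ρ) (iht ht.2.2 ρ)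
  | fold c v s t ihs iht =>
    exact Formula.fold_inPL ht.1 (ihs ht.2.1 ρ) (fun i => iht ht.2.2 _) _

end Template

/-! ### Templates are instantiated in logarithmic space -/

namespace Prog

variable {V : Type} [DecidableEq V]

/-- Run `p` with both heads of the loop variable `v` at each index of their tuples. Both heads
start at the first entries of their tuples, and return there. -/
def forEach (v : V) (p : Prog (V × Bool)) : Prog (V × Bool) :=
  seq (loop (fun z => z (v, false) ≠ InputCell.letter Letter.semicolon)
      (seq p (seq (pass (v, false) Letter.comma) (pass (v, true) Letter.comma))))
    (seq (backTo (v, false) [Letter.semicolon]) (backTo (v, true) [Letter.semicolon]))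

/-- The head positions if `τ` assigns to each head the number of its tuple and `ρ` gives the
current indices. -/
def headPos (Ts : List (List PureFormula)) (τ : V × Bool → ℕ) (ρ : V → ℕ) : V × Bool → ℕ :=
  fun x => entryPos Ts (τ x) (ρ x.1)

theorem update_headPos (Ts : List (List PureFormula)) (τ : V × Bool → ℕ) (ρ : V → ℕ) (v : V)
    (i : ℕ) :
    Function.update (Function.update (headPos Ts τ ρ) (v, false) (entryPos Ts (τ (v, false)) i))
      (v, true) (entryPos Ts (τ (v, true)) i) = headPos Ts τ (Function.update ρ v i) := by
  funext ⟨u, b⟩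
  by_cases hu : u = v
  · subst hu
    cases b <;> simp [headPos]
  · simp [headPos, hu]

variable {Ts : List (List PureFormula)} {τ : V × Bool → ℕ}

theorem eval_forEach (hτ : ∀ x, τ x < Ts.length) {v : V}
    (hlen : (Ts.getD (τ (v, true)) []).length = (Ts.getD (τ (v, false)) []).length)
    {ρ : V → ℕ} (hρ : ρ v = 0) {p : Prog (V × Bool)} {o : ℕ → List Letter}
    (hp : ∀ i < (Ts.getD (τ (v, false)) []).length,
      Eval (Ts.flatMap encodeTuple) p (headPos Ts τ (Function.update ρ v i))
        (headPos Ts τ (Function.update ρ v i)) (o i)) :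
    Eval (Ts.flatMap encodeTuple) (forEach v p) (headPos Ts τ ρ) (headPos Ts τ ρ)
      ((List.range (Ts.getD (τ (v, false)) []).length).flatMap o) := by
  set n := (Ts.getD (τ (v, false)) []).length with hn
  have hloop : ∀ j k, j + k = n → Eval (Ts.flatMap encodeTuple)
      (loop (fun z => z (v, false) ≠ InputCell.letter Letter.semicolon)
        (seq p (seq (pass (v, false) Letter.comma) (pass (v, true) Letter.comma))))
      (headPos Ts τ (Function.update ρ v j)) (headPos Ts τ (Function.update ρ v n))
      ((List.range' j k).flatMap o) := by
    intro j k hjk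
    induction k generalizing j with
    | zero =>
      obtain rfl : j = n := by omega
      refine Eval.loop_done ?_
      have := inputCell_entryPos_length (hτ (v, false))
      rw [← hn] at this
      simp [scan, headPos, this]
    | succ k ih =>
      have hj : j < n := by omega
      have hcell := inputCell_entryPos_ne (hτ (v, false)) (hn ▸ hj)
      have e₁ := eval_pass_comma (h := (v, false)) (hτ (v, false)) (hn ▸ hj)
        (pos := headPos Ts τ (Function.update ρ v j)) (by simp [headPos])
      have e₂ := eval_pass_comma (h := (v, true)) (hτ (v, true)) (hlen ▸ hj)
        (pos := Function.update (headPos Ts τ (Function.update ρ v j)) (v, false)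
          (entryPos Ts (τ (v, false)) (j + 1))) (by simp [headPos])
      rw [update_headPos, Function.update_idem] at e₂
      have := Eval.loop_step
        (b := fun z => decide (z (v, false) ≠ InputCell.letter Letter.semicolon))
        (by simpa [scan, headPos] using hcell) (Eval.seq (hp j hj) (Eval.seq e₁ e₂))
        (ih (j + 1) (by omega))
      simpa [List.range'_succ] using this
  have e₁ := eval_backTo_semicolon (h := (v, false)) (hτ (v, false))
    (pos := headPos Ts τ (Function.update ρ v n)) (by simp [headPos, n])
  have e₂ := eval_backTo_semicolon (h := (v, true)) (hτ (v, true))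
    (pos := Function.update (headPos Ts τ (Function.update ρ v n)) (v, false)
      (entryPos Ts (τ (v, false)) 0)) (by rw [hlen]; simp [headPos])
  rw [update_headPos, Function.update_idem, ← hρ, Function.update_eq_self] at e₂
  rw [← hρ] at e₁
  have e₀ := hloop 0 n (Nat.zero_add n)
  rw [← List.range_eq_range', ← hρ, Function.update_eq_self] at e₀
  have := Eval.seq e₀ (Eval.seq e₁ e₂)
  rw [List.append_nil, List.append_nil] at this
  exact this

end Prog

theorem Formula.encode_fold (c : BinConn) (φ : Formula) (ψ : ℕ → Formula) (n : ℕ) :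
    (fold c φ ψ n).encode = (List.range n).flatMap (fun _ => [Letter.lpar]) ++ (φ.encode ++
      (List.range n).flatMap fun i => [Letter.bin c] ++ ((ψ i).encode ++ [Letter.rpar])) := by
  have hpar (n : ℕ) : (List.range n).flatMap (fun _ => [Letter.lpar]) =
      List.replicate n Letter.lpar := by
    induction n with
    | zero => rfl
    | succ n ih => rw [List.range_succ, List.flatMap_append, ih, List.replicate_succ']; rfl
  induction n with
  | zero => simp [fold]
  | succ n ih =>
    rw [fold, encode_bin, ih, hpar, hpar, List.range_succ, List.flatMap_append,
      List.replicate_succ]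
    simp

namespace Template

variable {V : Type} [DecidableEq V]

open Prog in
/-- The program that emits the instances of a template. The closing parentheses of a fold come
after its members, and the opening ones in front, so it takes two passes. -/
def prog (sp : BinConn) : Template V → Prog (V × Bool)
  | const φ => emit fun _ => φ.encode
  | entry x b => copy sp b x
  | bin c s t =>
    seq (emit fun _ => [Letter.lpar]) (seq (s.prog sp) (seq (emit fun _ => [Letter.bin c])
      (seq (t.prog sp) (emit fun _ => [Letter.rpar]))))
  | fold c v s t =>
    seq (forEach v (emit fun _ => [Letter.lpar])) (seq (s.prog sp)
      (forEach v (seq (emit fun _ => [Letter.bin c])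
        (seq (t.prog sp) (emit fun _ => [Letter.rpar])))))

theorem eval_prog {Ts : List (List PureFormula)} {τ : V × Bool → ℕ} (hτ : ∀ x, τ x < Ts.length)
    (hlen : ∀ v, (Ts.getD (τ (v, true)) []).length = (Ts.getD (τ (v, false)) []).length)
    (sp : BinConn) {t : Template V} {B : Finset V} (ht : t.WellScoped B) {ρ : V → ℕ}
    (hB : ∀ v ∈ B, ρ v < (Ts.getD (τ (v, false)) []).length) (hB' : ∀ v ∉ B, ρ v = 0) :
    Prog.Eval (Ts.flatMap encodeTuple) (t.prog sp) (Prog.headPos Ts τ ρ) (Prog.headPos Ts τ ρ)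
      (t.inst sp (fun x => Ts.getD (τ x) []) ρ).encode := by
  induction t generalizing B ρ with
  | const φ => exact Prog.Eval.emit _ _
  | entry x b =>
    have hx : ρ x.1 < (Ts.getD (τ x) []).length := by
      obtain ⟨v, _ | _⟩ := x
      exacts [hB v ht, (hlen v) ▸ hB v ht]
    have := Prog.eval_copy (h := x) (sp := sp) (b := b) (hτ x) hx
      (pos := Prog.headPos Ts τ ρ) rfl
    simp only [inst, entryAt, List.getElem?_eq_getElem hx]
    exact this
  | bin c s t ihs iht =>
    simp only [inst, Formula.encode_bin]
    exact (Prog.Eval.emit _ _).seq ((ihs ht.1 hB hB').seq ((Prog.Eval.emit _ _).seq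
      ((iht ht.2 hB hB').seq (Prog.Eval.emit _ _))))
  | fold c v s t ihs iht =>
    simp only [inst, Formula.encode_fold]
    refine (Prog.eval_forEach hτ (hlen v) (hB' v ht.1) fun i _ => Prog.Eval.emit _ _).seq
      ((ihs ht.2.1 hB hB').seq (Prog.eval_forEach hτ (hlen v) (hB' v ht.1) fun i hi => ?_))
    refine (Prog.Eval.emit _ _).seq ((iht ht.2.2 ?_ ?_).seq (Prog.Eval.emit _ _))
    · intro u hu
      by_cases huv : u = v
      · subst huv; simpa using hi
      · simpa [huv] using hB u (Finset.mem_of_mem_insert_of_ne hu huv)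
    · intro u hu
      simp only [Finset.mem_insert, not_or] at hu
      simpa [hu.1] using hB' u hu.2

/-- The instances of a template are logspace-computable from the tuples: `Ts x` lists the tuples
of `x` and `τ` assigns them to the loop variables. The machine has two heads for each loop
variable and no work tapes. -/
theorem logspaceComputable [Fintype V] {X : Type} {enc : X → List Letter}
    (Ts : X → List (List PureFormula)) (henc : ∀ x, enc x = (Ts x).flatMap encodeTuple)
    {τ : V × Bool → ℕ} (hτ : ∀ x y, τ y < (Ts x).length)
    (hlen : ∀ x v, ((Ts x).getD (τ (v, true)) []).length =
      ((Ts x).getD (τ (v, false)) []).length)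
    (sp : BinConn) {t : Template V} (ht : t.WellScoped ∅) :
    LogspaceComputable enc
      (fun x => t.inst sp (fun y => (Ts x).getD (τ y) []) (fun _ => 0)) := by
  refine ⟨(Prog.seq (Prog.gotoAll τ Finset.univ.toList) (t.prog sp)).machine, 0, fun x => ⟨?_,
    Prog.spaceBoundedBy_machine _ _ _⟩⟩
  rw [henc]
  have e₁ := Prog.eval_gotoAll (hτ x) Finset.univ.toList (Finset.nodup_toList _)
    (pos := fun _ => 0) fun _ _ => rfl
  have e₂ := eval_prog (hτ x) (hlen x) sp ht (ρ := fun _ => 0)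
    (fun v hv => absurd hv (Finset.notMem_empty v)) fun _ _ => rfl
  simp only [Finset.mem_toList, Finset.mem_univ, if_true] at e₁
  exact (e₁.seq e₂).outputs

end Template

/-! ### Truth values of entries -/

/-- The truth value of the `i`-th entry of a tuple under an assignment. -/
noncomputable def Assignment.nth {Φ : Finset ℕ} (s : Assignment Φ) (α : List PureFormula) (i : ℕ) :
    Bool :=
  s.value (α[i]?.getD ⟨Formula.top, trivial⟩)

theorem Assignment.values_eq_iff {Φ : Finset ℕ} {s s' : Assignment Φ} {α β : List PureFormula}
    (h : α.length = β.length) :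
    s.values α = s'.values β ↔ ∀ i < α.length, s.nth α i = s'.nth β i := by
  simp only [values, List.ext_getElem_iff, List.length_map, List.getElem_map, nth]
  constructor
  · rintro ⟨-, h'⟩ i hi
    simpa [hi, h ▸ hi] using h' i hi (h ▸ hi)
  · intro h'
    exact ⟨h, fun i hi hi' => by simpa [hi, hi'] using h' i hi⟩

theorem Assignment.values_ne_iff {Φ : Finset ℕ} {s s' : Assignment Φ} {α β : List PureFormula}
    (h : α.length = β.length) :
    s.values α ≠ s'.values β ↔ ∃ i < α.length, s.nth α i ≠ s'.nth β i := by
  rw [Ne, values_eq_iff h]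
  push Not
  rfl

theorem Assignment.values_append_eq_iff {Φ : Finset ℕ} {s s' : Assignment Φ}
    {α β : List PureFormula} :
    s.values (α ++ β) = s'.values (α ++ β) ↔
      s.values α = s'.values α ∧ s.values β = s'.values β := by
  simp only [values, List.map_append]
  exact ⟨fun h => List.append_inj h (by simp), fun h => by rw [h.1, h.2]⟩

/-- The length of the `i`-th entry of a tuple. -/
def lengthAt (α : List PureFormula) (i : ℕ) : ℕ :=
  (α[i]?.getD ⟨Formula.top, trivial⟩).1.length

theorem sum_lengthAt (α : List PureFormula) :
    ∑ i ∈ Finset.range α.length, lengthAt α i = tupleLength α := by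
  induction α with
  | nil => rfl
  | cons φ α ih =>
    rw [List.length_cons, Finset.sum_range_succ', tupleLength, List.map_cons, List.sum_cons,
      ← tupleLength, ← ih, add_comm]
    simp [lengthAt]

theorem length_le_tupleLength (α : List PureFormula) : α.length ≤ tupleLength α := by
  induction α with
  | nil => exact le_rfl
  | cons φ α ih =>
    have h := φ.1.one_le_length
    simp only [tupleLength, List.map_cons, List.sum_cons, List.length_cons] at ih ⊢
    omega

theorem tupleLength_le_length_mul (α : List PureFormula) :
    tupleLength α ≤ α.length * tupleLength α := by
  cases α with
  | nil => exact le_rfl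
  | cons φ α => exact Nat.le_mul_of_pos_left _ (Nat.succ_pos _)

namespace Template

section

variable {V : Type} [DecidableEq V]

/-- An upper bound for the length of the instances of a template. -/
def size (A : V × Bool → List PureFormula) : Template V → (V → ℕ) → ℕ
  | const φ, _ => φ.length
  | entry x _, ρ => 2 * lengthAt (A x) (ρ x.1)
  | bin _ s t, ρ => s.size A ρ + t.size A ρ + 3
  | fold _ v s t, ρ => s.size A ρ +
      ∑ i ∈ Finset.range (A (v, false)).length, (t.size A (Function.update ρ v i) + 3)

theorem length_inst_le (sp : BinConn) (A : V × Bool → List PureFormula) (t : Template V)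
    (ρ : V → ℕ) : (t.inst sp A ρ).length ≤ t.size A ρ := by
  induction t generalizing ρ with
  | const φ => exact le_rfl
  | entry x b => exact Formula.length_signed_le sp b _
  | bin c s t ihs iht =>
    have := ihs ρ
    have := iht ρ
    simp only [inst, size, Formula.length_bin]
    omega
  | fold c v s t ihs iht =>
    simp only [inst, size, Formula.length_fold]
    exact add_le_add (ihs ρ) (Finset.sum_le_sum fun i _ => Nat.add_le_add_right (iht _) 3)

/-- A family of atoms whose negations are defined by the instances of one template, of suitable
size, is `NegationDefinable`. -/
theorem negationDefinable [Fintype V] {S : Set Connective} {X : Type} {enc : X → List Letter}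
    {atom : X → Atom} {bound : X → ℕ} {sp : BinConn} (hand : Connective.bin BinConn.and ∈ S)
    (hsp : Connective.bin sp ∈ S) (Ts : X → List (List PureFormula))
    (henc : ∀ x, enc x = (Ts x).flatMap encodeTuple) {τ : V × Bool → ℕ}
    (hτ : ∀ x y, τ y < (Ts x).length)
    (hlen : ∀ x v, ((Ts x).getD (τ (v, true)) []).length =
      ((Ts x).getD (τ (v, false)) []).length)
    {t : Template V} (ht : t.WellScoped ∅) (hS : t.Over S)
    (hsat : ∀ (x : X) (Φ : Finset ℕ) (T : Team Φ), (atom x).Sat T ↔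
      ¬ (t.inst sp (fun y => (Ts x).getD (τ y) []) (fun _ => 0)).Sat T)
    (C : ℕ) (hC : ∀ x, t.size (fun y => (Ts x).getD (τ y) []) (fun _ => 0) ≤
      C * max (bound x) 1) :
    NegationDefinable S enc atom bound :=
  ⟨C, _, logspaceComputable Ts henc hτ hlen sp ht, fun x => ⟨inst_inPL hand hsp _ hS _,
    fun Φ _ T => hsat x Φ T, (length_inst_le _ _ _ _).trans (hC x)⟩⟩

end

/-! ### Building blocks -/

variable {V : Type}

/-- The team is not empty. -/
def nonempty : Template V := const (Formula.snot Formula.bot)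

/-- No team satisfies this. -/
def falsum : Template V := const (Formula.snot Formula.top)

/-- Every team satisfies this. -/
def verum : Template V := const Formula.top

/-- Boolean disjunction over both truth values. -/
def someBool (t : Bool → Template V) : Template V := bin BinConn.bor (t true) (t false)

/-- Some assignment gives `x` the value `b`. -/
def someVal (sp : BinConn) (x : V × Bool) (b : Bool) : Template V :=
  bin sp verum (bin BinConn.and nonempty (entry x b))

/-- All assignments give `x` the same value. -/
def constant (x : V × Bool) : Template V := someBool fun d => entry x d

/-- All assignments that give `x` the value `b` give `y` the value `d`. -/
def whereVal (sp : BinConn) (x : V × Bool) (b : Bool) (y : V × Bool) (d : Bool) : Template V :=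
  bin sp (entry x (!b)) (entry y d)

/-- The value of `y` is constant where `x` has the value `b`, the value of `z` is constant where
`x` does not have the value `b`, and these constants are equal or different, according to `e`. -/
def compareVals (sp : BinConn) (x : V × Bool) (b : Bool) (y z : V × Bool) (e : Bool) : Template V :=
  someBool fun d => bin BinConn.and (whereVal sp x b y d) (whereVal sp x (!b) z (d == e))

/-- The team splits into a team for `t` and teams, one for each index of `v`, that contain an
assignment with the value `b` of `x` and in which the value of `(v, false)` where `x` is `b`
differs from the value of `(v, true)` where `x` is not `b`. For each index, the value of
`(v, false)` is the same for all assignments of the whole team with the value `b` of `x`, so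
that it does not matter which one of them the subteams contain. -/
def separate (x : V × Bool) (b : Bool) (v : V) (t : Template V) : Template V :=
  bin BinConn.and
    (fold BinConn.and v verum (someBool fun d => whereVal BinConn.split x b (v, false) d))
    (fold BinConn.split v t (bin BinConn.and (someVal BinConn.split x b)
      (compareVals BinConn.split x b (v, false) (v, true) false)))

/-- For some assignment `t` with the value `b` of `x` that satisfies `r`, the values of the tuple
`(v, false)` under `t` differ from the values of the tuple `(v, true)` under each assignment that
does not have the value `b` of `x`. -/
def isolate (x : V × Bool) (b : Bool) (v : V) (r : Template V) : Template V :=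
  separate x b v (bin BinConn.and nonempty (bin BinConn.and (entry x b) r))

section Shape

variable {S : Set Connective} {sp : BinConn}

theorem over_verum : (verum : Template V).Over S := InPL.basic trivial

theorem over_falsum : (falsum : Template V).Over S := InPL.snotBasic trivial

theorem over_nonempty : (nonempty : Template V).Over S := InPL.snotBasic trivial

theorem over_someBool (hbor : Connective.bin BinConn.bor ∈ S) {t : Bool → Template V}
    (h : ∀ d, (t d).Over S) : (someBool t).Over S :=
  ⟨hbor, h true, h false⟩

theorem over_someVal (hand : Connective.bin BinConn.and ∈ S) (hsp : Connective.bin sp ∈ S)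
    (x : V × Bool) (b : Bool) : (someVal sp x b).Over S :=
  ⟨hsp, over_verum, hand, over_nonempty, trivial⟩

theorem over_constant (hbor : Connective.bin BinConn.bor ∈ S) (x : V × Bool) :
    (constant x).Over S :=
  over_someBool hbor fun _ => trivial

theorem over_whereVal (hsp : Connective.bin sp ∈ S) (x : V × Bool) (b : Bool) (y : V × Bool)
    (d : Bool) : (whereVal sp x b y d).Over S :=
  ⟨hsp, trivial, trivial⟩

theorem over_compareVals (hbor : Connective.bin BinConn.bor ∈ S)
    (hand : Connective.bin BinConn.and ∈ S) (hsp : Connective.bin sp ∈ S) (x : V × Bool) (b : Bool)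
    (y z : V × Bool) (e : Bool) : (compareVals sp x b y z e).Over S :=
  over_someBool hbor fun _ => ⟨hand, over_whereVal hsp _ _ _ _, over_whereVal hsp _ _ _ _⟩

theorem over_separate (hbor : Connective.bin BinConn.bor ∈ S)
    (hand : Connective.bin BinConn.and ∈ S) (hsplit : Connective.bin BinConn.split ∈ S)
    (x : V × Bool) (b : Bool) (v : V) {t : Template V} (ht : t.Over S) :
    (separate x b v t).Over S :=
  ⟨hand, ⟨hand, over_verum, over_someBool hbor fun _ => over_whereVal hsplit _ _ _ _⟩,
    hsplit, ht, hand, over_someVal hand hsplit _ _, over_compareVals hbor hand hsplit _ _ _ _ _⟩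

theorem over_isolate (hbor : Connective.bin BinConn.bor ∈ S)
    (hand : Connective.bin BinConn.and ∈ S) (hsplit : Connective.bin BinConn.split ∈ S)
    (x : V × Bool) (b : Bool) (v : V) {r : Template V} (hr : r.Over S) :
    (isolate x b v r).Over S :=
  over_separate hbor hand hsplit x b v ⟨hand, over_nonempty, hand, trivial, hr⟩

variable [DecidableEq V] {A : V × Bool → List PureFormula} {ρ : V → ℕ}

theorem size_someVal (x : V × Bool) (b : Bool) :
    (someVal sp x b).size A ρ = 2 * lengthAt (A x) (ρ x.1) + 9 := by
  simp [someVal, size, verum, nonempty]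
  omega

theorem size_compareVals (x : V × Bool) (b : Bool) (y z : V × Bool) (e : Bool) :
    (compareVals sp x b y z e).size A ρ = 8 * lengthAt (A x) (ρ x.1) +
      4 * lengthAt (A y) (ρ y.1) + 4 * lengthAt (A z) (ρ z.1) + 21 := by
  simp only [compareVals, someBool, whereVal, size]
  omega

theorem size_separate {x : V × Bool} {v : V} (hx : x.1 ≠ v)
    (hlen : (A (v, true)).length = (A (v, false)).length) (b : Bool) (t : Template V) :
    (separate x b v t).size A ρ = t.size A ρ +
      (A (v, false)).length * (14 * lengthAt (A x) (ρ x.1) + 48) +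
      8 * tupleLength (A (v, false)) + 4 * tupleLength (A (v, true)) + 4 := by
  have h := sum_lengthAt (A (v, true))
  rw [hlen] at h
  simp only [separate, size, someBool, whereVal, size_someVal, size_compareVals, verum,
    Formula.length_top, Function.update_self, Function.update_of_ne hx, Finset.sum_add_distrib,
    ← Finset.mul_sum, sum_lengthAt, h, Finset.sum_const, Finset.card_range, smul_eq_mul]
  ring

theorem size_isolate {x : V × Bool} {v : V} (hx : x.1 ≠ v)
    (hlen : (A (v, true)).length = (A (v, false)).length) (b : Bool) (r : Template V) :
    (isolate x b v r).size A ρ = r.size A ρ + 2 * lengthAt (A x) (ρ x.1) +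
      (A (v, false)).length * (14 * lengthAt (A x) (ρ x.1) + 48) +
      8 * tupleLength (A (v, false)) + 4 * tupleLength (A (v, true)) + 12 := by
  rw [isolate, size_separate hx hlen]
  simp only [size, nonempty, Formula.length_snot, Formula.length_bot]
  ring

end Shape

section Semantics

variable [DecidableEq V] {Φ : Finset ℕ} {sp : BinConn} {A : V × Bool → List PureFormula}
  {ρ : V → ℕ} {T : Team Φ}

theorem sat_bin (c : BinConn) (s t : Template V) :
    ((bin c s t).inst sp A ρ).Sat T ↔ c.sem (s.inst sp A ρ).Sat (t.inst sp A ρ).Sat T :=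
  Iff.rfl

@[simp]
theorem sat_bin_and (s t : Template V) :
    ((bin BinConn.and s t).inst sp A ρ).Sat T ↔
      (s.inst sp A ρ).Sat T ∧ (t.inst sp A ρ).Sat T :=
  Iff.rfl

@[simp]
theorem sat_bin_bor (s t : Template V) :
    ((bin BinConn.bor s t).inst sp A ρ).Sat T ↔
      (s.inst sp A ρ).Sat T ∨ (t.inst sp A ρ).Sat T :=
  Iff.rfl

@[simp]
theorem sat_verum : ((verum : Template V).inst sp A ρ).Sat T := trivial

@[simp]
theorem not_sat_falsum : ¬ ((falsum : Template V).inst sp A ρ).Sat T := fun h => h trivial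

@[simp]
theorem sat_nonempty : ((nonempty : Template V).inst sp A ρ).Sat T ↔ T.Nonempty :=
  Set.nonempty_iff_ne_empty.symm

@[simp]
theorem sat_someBool (t : Bool → Template V) :
    ((someBool t).inst sp A ρ).Sat T ↔ ∃ d, ((t d).inst sp A ρ).Sat T := by
  rw [someBool, sat_bin_bor, Bool.exists_bool, or_comm]

@[simp]
theorem sat_fold_and (v : V) (s t : Template V) :
    ((fold BinConn.and v s t).inst sp A ρ).Sat T ↔ (s.inst sp A ρ).Sat T ∧
      ∀ i < (A (v, false)).length, (t.inst sp A (Function.update ρ v i)).Sat T :=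
  Formula.sat_fold_and _ _ _

@[simp]
theorem sat_fold_bor (v : V) (s t : Template V) :
    ((fold BinConn.bor v s t).inst sp A ρ).Sat T ↔ (s.inst sp A ρ).Sat T ∨
      ∃ i < (A (v, false)).length, (t.inst sp A (Function.update ρ v i)).Sat T :=
  Formula.sat_fold_bor _ _ _

section

variable (hsp : sp.IsSplitting)
include hsp

theorem sat_entry_eq (x : V × Bool) (b : Bool) :
    ((entry x b).inst sp A ρ).Sat = fun T : Team Φ => ∀ s ∈ T, s.nth (A x) (ρ x.1) = b :=
  PureFormula.sat_signed hsp _ b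

theorem sat_entry (x : V × Bool) (b : Bool) :
    ((entry x b).inst sp A ρ).Sat T ↔ ∀ s ∈ T, s.nth (A x) (ρ x.1) = b :=
  iff_of_eq (congrFun (sat_entry_eq hsp x b) T)

theorem sat_bin_verum (t : Template V) :
    ((bin sp verum t).inst sp A ρ).Sat T ↔ ∃ U ⊆ T, (t.inst sp A ρ).Sat U :=
  hsp.sem_top

theorem sat_someVal (x : V × Bool) (b : Bool) :
    ((someVal sp x b).inst sp A ρ).Sat T ↔ ∃ s ∈ T, s.nth (A x) (ρ x.1) = b := by
  simp only [someVal, sat_bin_verum hsp, sat_bin_and, sat_nonempty, sat_entry hsp]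
  constructor
  · rintro ⟨U, hU, ⟨s, hs⟩, h⟩
    exact ⟨s, hU hs, h s hs⟩
  · rintro ⟨s, hs, h⟩
    exact ⟨{s}, Set.singleton_subset_iff.2 hs, Set.singleton_nonempty s, by simpa using h⟩

theorem sat_constant (x : V × Bool) :
    ((constant x).inst sp A ρ).Sat T ↔ ∃ d, ∀ s ∈ T, s.nth (A x) (ρ x.1) = d := by
  simp only [constant, sat_someBool, sat_entry hsp]

theorem sat_whereVal (x : V × Bool) (b : Bool) (y : V × Bool) (d : Bool) :
    ((whereVal sp x b y d).inst sp A ρ).Sat T ↔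
      ∀ s ∈ T, s.nth (A x) (ρ x.1) = b → s.nth (A y) (ρ y.1) = d := by
  rw [whereVal, sat_bin, sat_entry_eq hsp, sat_entry_eq hsp, hsp.sem_flat]
  refine forall₂_congr fun s _ => ?_
  rw [Bool.eq_not, ← imp_iff_not_or]

theorem sat_compareVals (x : V × Bool) (b : Bool) (y z : V × Bool) (e : Bool) :
    ((compareVals sp x b y z e).inst sp A ρ).Sat T ↔
      ∃ d, (∀ s ∈ T, s.nth (A x) (ρ x.1) = b → s.nth (A y) (ρ y.1) = d) ∧
        ∀ s ∈ T, s.nth (A x) (ρ x.1) = (!b) → s.nth (A z) (ρ z.1) = (d == e) := by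
  simp only [compareVals, sat_someBool, sat_bin_and, sat_whereVal hsp]

end

theorem sat_split_flat {r : Template V} {P : Assignment Φ → Prop}
    (hr : ∀ T : Team Φ, (r.inst sp A ρ).Sat T ↔ ∀ s ∈ T, P s) (t : Template V) :
    ((bin BinConn.split r t).inst sp A ρ).Sat T ↔
      ∃ U ⊆ T, (∀ s ∈ T, s ∉ U → P s) ∧ (t.inst sp A ρ).Sat U := by
  have hr' : (r.inst sp A ρ).Sat = fun T : Team Φ => ∀ s ∈ T, P s := funext fun T => propext (hr T)
  rw [sat_bin, hr', sem_split_flat_left]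

theorem sat_split_entry (x : V × Bool) (b : Bool) (t : Template V) :
    ((bin BinConn.split (entry x b) t).inst BinConn.split A ρ).Sat T ↔
      ∃ U ⊆ T, (∀ s ∈ T, s ∉ U → s.nth (A x) (ρ x.1) = b) ∧ (t.inst BinConn.split A ρ).Sat U :=
  sat_split_flat (fun _ => sat_entry (Or.inl rfl) x b) t

variable {x : V × Bool} {b : Bool} {v : V} {t : Template V}

/-- In a team that satisfies `separate x b v t`, the assignments without the value `b` of `x` that
agree with some assignment with the value `b` of `x` are in the part of the team for `t`. -/
theorem exists_of_sat_separate (hx : x.1 ≠ v)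
    (h : ((separate x b v t).inst BinConn.split A ρ).Sat T) :
    ∃ B ⊆ T, (t.inst BinConn.split A ρ).Sat B ∧
      ∀ s ∈ T, s.nth (A x) (ρ x.1) = b → ∀ s' ∈ T, s'.nth (A x) (ρ x.1) = (!b) →
        (∀ i < (A (v, false)).length, s.nth (A (v, false)) i = s'.nth (A (v, true)) i) →
          s' ∈ B := by
  have hsp : BinConn.split.IsSplitting := Or.inl rfl
  simp only [separate, sat_bin_and, sat_fold_and, sat_verum, true_and, sat_someBool,
    sat_whereVal hsp, Function.update_of_ne hx, Function.update_self] at h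
  obtain ⟨hconst, h⟩ := h
  obtain ⟨B, U, hB, hBT, hU, hcov⟩ := (Formula.sat_fold_split _ _ _).1 h
  refine ⟨B, hBT, hB, fun s hs hxs s' hs' hxs' heq => (hcov s' hs').resolve_right ?_⟩
  rintro ⟨i, hi, hs'U⟩
  obtain ⟨hUT, hsat⟩ := hU i hi
  simp only [sat_bin_and, sat_someVal hsp, sat_compareVals hsp, Function.update_of_ne hx,
    Function.update_self, beq_false] at hsat
  obtain ⟨⟨r, hr, hxr⟩, d, h₁, h₂⟩ := hsat
  obtain ⟨d', hd'⟩ := hconst i hi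
  have e₁ : s.nth (A (v, false)) i = d := by
    rw [hd' s hs hxs, ← hd' r (hUT hr) hxr, h₁ r hr hxr]
  have e₂ := h₂ s' hs'U hxs'
  rw [← heq i hi, e₁] at e₂
  simp at e₂

/-- A team with exactly one assignment `s` with the value `b` of `x` satisfies `separate x b v t`
if some part of it satisfies `t` and contains `s` and all assignments that agree with `s`. -/
theorem sat_separate_of_unique (hx : x.1 ≠ v) {s : Assignment Φ} (hs : s ∈ T)
    (hxs : s.nth (A x) (ρ x.1) = b) (huniq : ∀ s' ∈ T, s'.nth (A x) (ρ x.1) = b → s' = s)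
    {B : Team Φ} (hBT : B ⊆ T) (hB : (t.inst BinConn.split A ρ).Sat B) (hsB : s ∈ B)
    (hcov : ∀ s' ∈ T, s'.nth (A x) (ρ x.1) = (!b) →
      (∀ i < (A (v, false)).length, s.nth (A (v, false)) i = s'.nth (A (v, true)) i) → s' ∈ B) :
    ((separate x b v t).inst BinConn.split A ρ).Sat T := by
  have hsp : BinConn.split.IsSplitting := Or.inl rfl
  simp only [separate, sat_bin_and, sat_fold_and, sat_verum, true_and, sat_someBool,
    sat_whereVal hsp, Function.update_of_ne hx, Function.update_self]
  refine ⟨fun i _ => ⟨s.nth (A (v, false)) i, fun s' hs' h => by rw [huniq s' hs' h]⟩, ?_⟩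
  refine (Formula.sat_fold_split _ _ _).2 ⟨B, fun i => {s' ∈ T | s' = s ∨
    s'.nth (A x) (ρ x.1) = (!b) ∧ s.nth (A (v, false)) i ≠ s'.nth (A (v, true)) i}, hB, hBT,
    fun i _ => ⟨fun s' h => h.1, ?_⟩, fun s' hs' => ?_⟩
  · simp only [sat_bin_and, sat_someVal hsp, sat_compareVals hsp, Function.update_of_ne hx,
      Function.update_self, beq_false]
    refine ⟨⟨s, ⟨hs, Or.inl rfl⟩, hxs⟩, s.nth (A (v, false)) i, ?_, ?_⟩
    · intro s' hs' h
      rw [huniq s' hs'.1 h]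
    · rintro s' ⟨-, rfl | ⟨-, h⟩⟩ h'
      · rw [hxs] at h'
        simp at h'
      · exact Bool.eq_not.2 (Ne.symm h)
  · by_contra! hne
    by_cases hb : s'.nth (A x) (ρ x.1) = b
    · exact hne.1 (huniq s' hs' hb ▸ hsB)
    · refine hne.1 (hcov s' hs' (Bool.eq_not.2 hb) fun i hi => ?_)
      by_contra h
      exact hne.2 i hi ⟨hs', Or.inr ⟨Bool.eq_not.2 hb, h⟩⟩

variable {r : Template V} {P : Assignment Φ → Prop}

theorem exists_of_sat_isolate (hx : x.1 ≠ v)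
    (hr : ∀ T : Team Φ, (r.inst BinConn.split A ρ).Sat T ↔ ∀ s ∈ T, P s)
    (h : ((isolate x b v r).inst BinConn.split A ρ).Sat T) :
    ∃ s ∈ T, s.nth (A x) (ρ x.1) = b ∧ P s ∧ ∀ s' ∈ T, s'.nth (A x) (ρ x.1) = (!b) →
      ∃ i < (A (v, false)).length, s.nth (A (v, false)) i ≠ s'.nth (A (v, true)) i := by
  obtain ⟨B, hBT, hB, hsep⟩ := exists_of_sat_separate hx h
  simp only [sat_bin_and, sat_nonempty, sat_entry (Or.inl rfl), hr] at hB
  obtain ⟨⟨s, hs⟩, hxB, hP⟩ := hB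
  refine ⟨s, hBT hs, hxB s hs, hP s hs, fun s' hs' hxs' => ?_⟩
  by_contra! hne
  have := hxB s' (hsep s (hBT hs) (hxB s hs) s' hs' hxs' hne)
  rw [hxs'] at this
  simp at this

theorem sat_isolate_of_unique (hx : x.1 ≠ v)
    (hr : ∀ T : Team Φ, (r.inst BinConn.split A ρ).Sat T ↔ ∀ s ∈ T, P s) {s : Assignment Φ}
    (hs : s ∈ T) (hxs : s.nth (A x) (ρ x.1) = b) (hP : P s)
    (huniq : ∀ s' ∈ T, s'.nth (A x) (ρ x.1) = b → s' = s)
    (h : ∀ s' ∈ T, s'.nth (A x) (ρ x.1) = (!b) →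
      ∃ i < (A (v, false)).length, s.nth (A (v, false)) i ≠ s'.nth (A (v, true)) i) :
    ((isolate x b v r).inst BinConn.split A ρ).Sat T := by
  refine sat_separate_of_unique hx hs hxs huniq (Set.singleton_subset_iff.2 hs) ?_
    (Set.mem_singleton s) ?_
  · simp only [sat_bin_and, sat_nonempty, sat_entry (Or.inl rfl), hr]
    exact ⟨Set.singleton_nonempty s, by simpa using hxs, by simpa using hP⟩
  · intro s' hs' hxs' heq
    obtain ⟨i, hi, hne⟩ := h s' hs' hxs'
    exact absurd (heq i hi) hne

/-- If the other assignments with the value `b` of `x` are split off, the rest of the team can be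
chosen so that `isolate` speaks about a single assignment. -/
theorem sat_split_isolate (hx : x.1 ≠ v)
    (hr : ∀ T : Team Φ, (r.inst BinConn.split A ρ).Sat T ↔ ∀ s ∈ T, P s) :
    ((bin BinConn.split (entry x b) (isolate x b v r)).inst BinConn.split A ρ).Sat T ↔
      ∃ s ∈ T, s.nth (A x) (ρ x.1) = b ∧ P s ∧ ∀ s' ∈ T, s'.nth (A x) (ρ x.1) = (!b) →
        ∃ i < (A (v, false)).length, s.nth (A (v, false)) i ≠ s'.nth (A (v, true)) i := by
  rw [sat_split_entry]
  constructor
  · rintro ⟨U, hUT, hout, h⟩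
    obtain ⟨s, hs, hxs, hP, hsep⟩ := exists_of_sat_isolate hx hr h
    refine ⟨s, hUT hs, hxs, hP, fun s' hs' hxs' => hsep s' ?_ hxs'⟩
    by_contra hn
    have := hout s' hs' hn
    rw [hxs'] at this
    simp at this
  · rintro ⟨s, hs, hxs, hP, hsep⟩
    refine ⟨{s' ∈ T | s' = s ∨ s'.nth (A x) (ρ x.1) = (!b)}, fun s' h => h.1, ?_,
      sat_isolate_of_unique hx hr ⟨hs, Or.inl rfl⟩ hxs hP ?_ fun s' hs' => hsep s' hs'.1⟩
    · intro s' hs' hn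
      by_contra hb
      exact hn ⟨hs', Or.inr (Bool.eq_not.2 hb)⟩
    · rintro s' ⟨-, h | h⟩ h'
      · exact h
      · rw [h'] at h
        simp at h

end Semantics

end Template

open Template

variable {Φ : Finset ℕ} {T : Team Φ}

/-! ### Dependence -/

/-- Some subteam gives a constant value to each entry of the first tuple and both values to some
entry of the second tuple. -/
def depTemplate (sp : BinConn) : Template (Fin 2) :=
  .bin sp verum (.bin .and (.fold .and 0 verum (constant (0, false)))
    (.fold .bor 1 falsum (.bin .and (someVal sp (1, false) true) (someVal sp (1, false) false))))

theorem sat_dep_iff {sp : BinConn} (hsp : sp.IsSplitting) {A : Fin 2 × Bool → List PureFormula} :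
    (Atom.dep (A (0, false)) (A (1, false))).Sat T ↔
      ¬ ((depTemplate sp).inst sp A fun _ => 0).Sat T := by
  simp only [depTemplate, sat_bin_verum hsp, sat_bin_and, sat_fold_and, sat_fold_bor, sat_verum,
    not_sat_falsum, sat_constant hsp, sat_someVal hsp, Function.update_self, true_and, false_or]
  rw [← not_iff_not, not_not]
  simp only [Atom.Sat]
  push Not
  constructor
  · rintro ⟨s, hs, s', hs', hα, hβ⟩
    rw [Assignment.values_eq_iff rfl] at hα
    obtain ⟨j, hj, hne⟩ := (Assignment.values_ne_iff rfl).1 hβ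
    refine ⟨{s, s'}, Set.pair_subset hs hs', fun i hi => ⟨s.nth (A (0, false)) i, ?_⟩, j, hj, ?_⟩
    · rintro t (rfl | rfl)
      exacts [rfl, (hα i hi).symm]
    · cases h : s.nth (A (1, false)) j <;> cases h' : s'.nth (A (1, false)) j <;> simp_all
  · rintro ⟨U, hU, hα, j, hj, ⟨s, hs, h⟩, ⟨s', hs', h'⟩⟩
    refine ⟨s, hU hs, s', hU hs', (Assignment.values_eq_iff rfl).2 fun i hi => ?_,
      (Assignment.values_ne_iff rfl).2 ⟨j, hj, by rw [h, h']; simp⟩⟩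
    obtain ⟨d, hd⟩ := hα i hi
    rw [hd s hs, hd s' hs']

theorem dependenceBound {S : Set Connective} {sp : BinConn} (hsp : sp.IsSplitting)
    (hbor : Connective.bin BinConn.bor ∈ S) (hand : Connective.bin BinConn.and ∈ S)
    (hS : Connective.bin sp ∈ S) : DependenceBound S := by
  refine negationDefinable (t := depTemplate sp) (τ := fun y => y.1.val) hand hS
    (fun x => [x.1, x.2]) (fun x => by simp [TuplePair.encode])
    (fun x y => y.1.isLt) (fun x v => rfl) ?_ ?_ (fun x Φ T => ?_) 200 fun x => ?_
  · simp [depTemplate, WellScoped, verum, falsum, constant, someBool, someVal, Template.nonempty]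
  · exact ⟨hS, over_verum, hand, ⟨hand, over_verum, over_constant hbor _⟩, hbor, over_falsum, hand,
      over_someVal hand hS _ _, over_someVal hand hS _ _⟩
  · exact sat_dep_iff hsp (A := fun y => [x.1, x.2].getD y.1.val [])
  · have h₁ := length_le_tupleLength x.1
    have h₂ := length_le_tupleLength x.2
    simp [depTemplate, size, verum, falsum, constant, someBool, someVal, Template.nonempty,
      Finset.sum_add_distrib, ← Finset.mul_sum, sum_lengthAt]
    omega

/-! ### Exclusion -/

/-- The tuples agree under some assignment; or some subteam is divided by an entry of the second
tuple, with the values of the first tuple in one part equal to those of the second tuple in the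
other part. -/
def exclTemplate (sp : BinConn) : Template (Fin 2) :=
  .bin .bor
    (.bin sp verum (.bin .and nonempty (.fold .and 0 verum
      (someBool fun d => .bin .and (.entry (0, false) d) (.entry (0, true) d)))))
    (.fold .bor 0 falsum (someBool fun b => .bin sp verum
      (.bin .and (.bin .and (someVal sp (0, true) b) (someVal sp (0, true) (!b)))
        (.fold .and 1 verum (compareVals sp (0, true) b (1, false) (1, true) true)))))

theorem sat_excl_iff {sp : BinConn} (hsp : sp.IsSplitting) {A : Fin 2 × Bool → List PureFormula}
    (hA : ∀ x, (A x).length = (A (0, false)).length) (h₀ : A (1, false) = A (0, false))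
    (h₁ : A (1, true) = A (0, true)) :
    (Atom.excl (A (0, false)) (A (0, true))).Sat T ↔
      ¬ ((exclTemplate sp).inst sp A fun _ => 0).Sat T := by
  simp only [exclTemplate, sat_bin_verum hsp, sat_bin_and, sat_bin_bor, sat_fold_and, sat_fold_bor,
    sat_verum, not_sat_falsum, sat_entry hsp, sat_someBool, sat_someVal hsp, sat_compareVals hsp,
    sat_nonempty, Function.update_self, true_and, false_or, h₀, h₁, ne_eq, zero_ne_one,
    not_false_eq_true, Function.update_of_ne]
  rw [← not_iff_not, not_not]
  simp only [Atom.Sat]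
  push Not
  have hlen : (A (0, false)).length = (A (0, true)).length := (hA (0, true)).symm
  generalize A (0, false) = α at *
  generalize A (0, true) = β at *
  constructor
  · rintro ⟨s, hs, s', hs', h⟩
    have h' := (Assignment.values_eq_iff hlen).1 h
    by_cases heq : s.values α = s.values β
    · rw [Assignment.values_eq_iff hlen] at heq
      refine Or.inl ⟨{s}, Set.singleton_subset_iff.2 hs, Set.singleton_nonempty s,
        fun i hi => ⟨s.nth α i, ?_⟩⟩
      simpa using (heq i hi).symm
    · rw [h, ← Ne, Assignment.values_ne_iff rfl] at heq
      obtain ⟨j, hj, hne⟩ := heq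
      have hj' : s'.nth β j = !s.nth β j := Bool.eq_not.2 hne
      refine Or.inr ⟨j, hlen ▸ hj, s.nth β j, {s, s'}, Set.pair_subset hs hs',
        ⟨⟨s, by simp, rfl⟩, ⟨s', by simp, hj'⟩⟩, fun i hi => ⟨s.nth α i, ?_, ?_⟩⟩
      · rintro t (rfl | rfl) ht
        · rfl
        · exact absurd ht hne
      · rintro t (rfl | rfl) ht
        · simp at ht
        · simpa using (h' i hi).symm
  · rintro (⟨U, hU, ⟨s, hs⟩, h⟩ | ⟨j, hj, b, U, hU, ⟨⟨s, hs, hb⟩, ⟨s', hs', hb'⟩⟩, h⟩)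
    · refine ⟨s, hU hs, s, hU hs, (Assignment.values_eq_iff hlen).2 fun i hi => ?_⟩
      obtain ⟨d, h₁, h₂⟩ := h i hi
      rw [h₁ s hs, h₂ s hs]
    · refine ⟨s, hU hs, s', hU hs', (Assignment.values_eq_iff hlen).2 fun i hi => ?_⟩
      obtain ⟨d, h₁, h₂⟩ := h i hi
      rw [h₁ s hs hb, h₂ s' hs' hb']
      simp

theorem exclusionBound {S : Set Connective} {sp : BinConn} (hsp : sp.IsSplitting)
    (hbor : Connective.bin BinConn.bor ∈ S) (hand : Connective.bin BinConn.and ∈ S)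
    (hS : Connective.bin sp ∈ S) : ExclusionBound S := by
  refine negationDefinable (t := exclTemplate sp) (τ := fun y => y.2.toNat) hand hS
    (fun x => [x.1.1, x.1.2]) (fun x => by simp [EqualTuplePair.encode])
    (fun x y => Bool.toNat_lt y.2) (fun x v => x.2.symm) ?_ ?_ (fun x Φ T => ?_) 500 fun x => ?_
  · simp [exclTemplate, WellScoped, verum, falsum, someBool, someVal, Template.nonempty,
      compareVals, whereVal]
  · exact ⟨hbor, ⟨hS, over_verum, hand, over_nonempty, hand, over_verum,
      over_someBool hbor fun _ => ⟨hand, trivial, trivial⟩⟩, hbor, over_falsum,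
      over_someBool hbor fun _ => ⟨hS, over_verum, hand, ⟨hand, over_someVal hand hS _ _,
        over_someVal hand hS _ _⟩, hand, over_verum, over_compareVals hbor hand hS _ _ _ _ _⟩⟩
  · refine sat_excl_iff hsp (A := fun y => [x.1.1, x.1.2].getD y.2.toNat []) ?_ rfl rfl
    rintro ⟨v, _ | _⟩
    exacts [rfl, x.2.symm]
  · obtain ⟨⟨α, β⟩, h⟩ := x
    dsimp only at h ⊢
    have h₁ := length_le_tupleLength α
    have h₂ := length_le_tupleLength β
    have hβ := sum_lengthAt β
    rw [← h] at hβ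
    have h₃ := tupleLength_le_length_mul α
    have h₄ := tupleLength_le_length_mul β
    rw [← h] at h₄
    have h₅ := Nat.mul_le_mul_left α.length h₁
    simp [exclTemplate, size, verum, falsum, someBool, size_someVal, Template.nonempty,
      size_compareVals, Finset.sum_add_distrib, ← Finset.mul_sum, sum_lengthAt, hβ]
    have h₆ := le_max_left (α.length * (tupleLength α + tupleLength β)) 1
    have h₇ := le_max_right (α.length * (tupleLength α + tupleLength β)) 1
    linarith

/-! ### Inclusion -/

/-- Some entry of the second tuple has the value `b` under an assignment `s` that gives the
corresponding entry of the first tuple the other value, and the first tuple under `s` differs from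
the second tuple under all assignments for which that entry of the second tuple does not already
make the difference. -/
def inclTemplate : Template (Fin 2) :=
  .fold .bor 0 falsum (someBool fun b => .bin .split (.entry (0, true) b)
    (isolate (0, true) b 1 (.entry (0, false) (!b))))

theorem sat_incl_iff {A : Fin 2 × Bool → List PureFormula}
    (hA : ∀ x, (A x).length = (A (0, false)).length) (h₀ : A (1, false) = A (0, false))
    (h₁ : A (1, true) = A (0, true)) :
    (Atom.incl (A (0, false)) (A (0, true))).Sat T ↔
      ¬ (inclTemplate.inst .split A fun _ => 0).Sat T := by
  have hlen : (A (0, false)).length = (A (0, true)).length := (hA (0, true)).symm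
  simp only [inclTemplate, sat_fold_bor, not_sat_falsum, false_or, sat_someBool,
    sat_split_isolate (x := (0, true)) (v := (1 : Fin 2)) zero_ne_one
      fun _ => sat_entry (.inl rfl) (0, false) _, Function.update_self, h₀, h₁]
  rw [← not_iff_not, not_not]
  simp only [Atom.Sat]
  push Not
  generalize A (0, false) = α at *
  generalize A (0, true) = β at *
  constructor
  · rintro ⟨s, hs, h⟩
    obtain ⟨j, hj, hne⟩ := (Assignment.values_ne_iff hlen).1 (h s hs)
    exact ⟨j, hj, s.nth β j, s, hs, rfl, Bool.eq_not.2 hne,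
      fun s' hs' _ => (Assignment.values_ne_iff hlen).1 (h s' hs')⟩
  · rintro ⟨j, hj, b, s, hs, hb, hb', h⟩
    refine ⟨s, hs, fun s' hs' => (Assignment.values_ne_iff hlen).2 ?_⟩
    by_cases hj' : s'.nth β j = b
    · exact ⟨j, hj, by rw [hb', hj']; simp⟩
    · exact h s' hs' (Bool.eq_not.2 hj')

theorem inclusionBound {S : Set Connective} (hbor : Connective.bin BinConn.bor ∈ S)
    (hand : Connective.bin BinConn.and ∈ S) (hS : Connective.bin BinConn.split ∈ S) :
    InclusionBound S := by
  refine negationDefinable (t := inclTemplate) (τ := fun y => y.2.toNat) hand hS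
    (fun x => [x.1.1, x.1.2]) (fun x => by simp [EqualTuplePair.encode])
    (fun x y => Bool.toNat_lt y.2) (fun x v => x.2.symm) ?_ ?_ (fun x Φ T => ?_) 500 fun x => ?_
  · simp [inclTemplate, WellScoped, verum, falsum, someBool, someVal, Template.nonempty,
      compareVals, whereVal, isolate, separate]
  · exact ⟨hbor, over_falsum, over_someBool hbor fun _ => ⟨hS, trivial,
      over_isolate hbor hand hS _ _ _ trivial⟩⟩
  · refine sat_incl_iff (A := fun y => [x.1.1, x.1.2].getD y.2.toNat []) ?_ rfl rfl
    rintro ⟨v, _ | _⟩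
    exacts [rfl, x.2.symm]
  · obtain ⟨⟨α, β⟩, h⟩ := x
    dsimp only at h ⊢
    have h₁ := length_le_tupleLength α
    have h₂ := length_le_tupleLength β
    have hβ := sum_lengthAt β
    rw [← h] at hβ
    have h₃ := tupleLength_le_length_mul α
    have h₄ := tupleLength_le_length_mul β
    rw [← h] at h₄
    have h₅ := Nat.mul_le_mul_left α.length h₁
    have h₆ := le_max_left (α.length * (tupleLength α + tupleLength β)) 1
    have h₇ := le_max_right (α.length * (tupleLength α + tupleLength β)) 1
    simp [inclTemplate, size, falsum, someBool, size_isolate, ← h,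
      Finset.sum_add_distrib, ← Finset.mul_sum, sum_lengthAt, hβ]
    linarith

/-! ### Unary anonymity -/

/-- The single formula has the value `b` under some assignment whose values of the tuple differ
from those under all assignments with the other value of the formula. -/
def anonTemplate : Template (Fin 2) :=
  .fold .bor 0 falsum (someBool fun b => .bin .split (.entry (0, false) b)
    (isolate (0, false) b 1 verum))

theorem sat_anon_iff {A : Fin 2 × Bool → List PureFormula}
    (hA : (A (0, false)).length = 1) (h₁ : A (1, true) = A (1, false)) :
    (Atom.anon (A (1, false)) (A (0, false))).Sat T ↔
      ¬ (anonTemplate.inst .split A fun _ => 0).Sat T := by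
  simp only [anonTemplate, sat_fold_bor, not_sat_falsum, false_or, sat_someBool,
    sat_split_isolate (x := (0, false)) (v := (1 : Fin 2)) (P := fun _ => True) zero_ne_one
      fun _ => iff_of_true sat_verum fun _ _ => trivial, Function.update_self, h₁, true_and]
  rw [← not_iff_not, not_not]
  simp only [Atom.Sat]
  push Not
  generalize A (0, false) = β at *
  generalize A (1, false) = α at *
  have hβ (s s' : Assignment Φ) : s.values β = s'.values β ↔ s.nth β 0 = s'.nth β 0 := by
    rw [Assignment.values_eq_iff rfl, hA]
    simp
  constructor
  · rintro ⟨s, hs, h⟩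
    refine ⟨0, by omega, s.nth β 0, s, hs, rfl, fun s' hs' hne => ?_⟩
    refine (Assignment.values_ne_iff rfl).1 fun heq => ?_
    rw [← (hβ _ _).1 (h s' hs' heq)] at hne
    simp at hne
  · rintro ⟨j, hj, b, s, hs, hb, h⟩
    obtain rfl : j = 0 := by omega
    refine ⟨s, hs, fun s' hs' heq => (hβ _ _).2 ?_⟩
    rw [hb]
    by_contra hne
    exact (Assignment.values_ne_iff rfl).2 (h s' hs' (Bool.eq_not.2 (Ne.symm hne))) heq

theorem unaryAnonymityBound {S : Set Connective} (hbor : Connective.bin BinConn.bor ∈ S)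
    (hand : Connective.bin BinConn.and ∈ S) (hS : Connective.bin BinConn.split ∈ S) :
    UnaryAnonymityBound S := by
  refine negationDefinable (t := anonTemplate) (τ := fun y => ![1, 0] y.1) hand hS
    (fun x => [x.1, [x.2]]) (fun x => by simp [TupleFormula.encode])
    (fun x y => ?_) (fun x v => rfl) ?_ ?_ (fun x Φ T => ?_) 500 fun x => ?_
  · rcases y with ⟨v, b⟩
    fin_cases v <;> simp
  · simp [anonTemplate, WellScoped, verum, falsum, someBool, someVal, Template.nonempty,
      compareVals, whereVal, isolate, separate]
  · exact ⟨hbor, over_falsum, over_someBool hbor fun _ => ⟨hS, trivial,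
      over_isolate hbor hand hS _ _ _ over_verum⟩⟩
  · exact sat_anon_iff (A := fun y => [x.1, [x.2]].getD (![1, 0] y.1) []) rfl rfl
  · obtain ⟨α, β⟩ := x
    dsimp only
    have h₁ := length_le_tupleLength α
    simp [anonTemplate, size, falsum, verum, someBool, size_isolate, lengthAt]
    have h₂ := Nat.mul_le_mul_right β.1.length (le_max_left α.length 1)
    have h₃ := Nat.mul_le_mul_right β.1.length (le_max_right α.length 1)
    have h₄ := le_max_left (max α.length 1 * β.1.length + tupleLength α) 1
    have h₅ := le_max_right (max α.length 1 * β.1.length + tupleLength α) 1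
    linarith

/-! ### Conditional independence -/

/-- Among the assignments that agree with `s'` on `β` and `γ`, together with an assignment `s`
that agrees with `s'` on `γ` only, the latter is singled out by an entry of `β` and differs on `α`
from all others. Here `s'` is singled out by the value `b` of an entry of `α`. -/
def indepCore (b : Bool) : Template (Fin 4) :=
  .bin .and (someVal .split (0, false) b) (.fold .bor 1 falsum (someBool fun d =>
    .bin .and (whereVal .split (0, false) b (1, false) (!d))
      (.bin .and
        (.bin .split (.bin .and (.entry (0, false) (!b)) (.entry (1, false) (!d)))
          (.fold .and 2 verum (constant (2, false))))
        (.bin .split (.entry (0, false) b) (isolate (1, false) d 3 verum)))))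

/-- The variables `0` and `3` run through `α`, `1` through `β`, and `2` through `γ`. -/
def indepTemplate : Template (Fin 4) :=
  .fold .bor 0 falsum (someBool fun b => .bin .split (.entry (0, false) b)
    (separate (0, false) b 1 (separate (0, false) b 2 (indepCore b))))

theorem sat_indepCore {A : Fin 4 × Bool → List PureFormula} {ρ : Fin 4 → ℕ} {b : Bool} :
    ((indepCore b).inst .split A ρ).Sat T ↔
      (∃ s ∈ T, s.nth (A (0, false)) (ρ 0) = b) ∧ ∃ l < (A (1, false)).length, ∃ d,
        (∀ s ∈ T, s.nth (A (0, false)) (ρ 0) = b → s.nth (A (1, false)) l = !d) ∧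
        (∃ Y ⊆ T, (∀ s ∈ T, s ∉ Y →
            s.nth (A (0, false)) (ρ 0) = (!b) ∧ s.nth (A (1, false)) l = !d) ∧
          ∀ i < (A (2, false)).length, ∃ e, ∀ s ∈ Y, s.nth (A (2, false)) i = e) ∧
        ∃ W ⊆ T, (∀ s ∈ T, s ∉ W → s.nth (A (0, false)) (ρ 0) = b) ∧
          ((isolate (1, false) d 3 verum).inst .split A (Function.update ρ 1 l)).Sat W := by
  have hsp : BinConn.split.IsSplitting := .inl rfl
  have hflat (d : Bool) (ρ : Fin 4 → ℕ) (T : Team Φ) :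
      ((Template.bin .and (.entry (0, false) (!b)) (.entry (1, false) (!d))).inst .split A ρ).Sat T
        ↔ ∀ s ∈ T, s.nth (A (0, false)) (ρ 0) = (!b) ∧ s.nth (A (1, false)) (ρ 1) = !d := by
    rw [sat_bin_and, sat_entry hsp, sat_entry hsp, ← forall₂_and]
  simp only [indepCore, sat_bin_and, sat_someVal hsp, sat_fold_bor, not_sat_falsum, false_or,
    sat_someBool, sat_whereVal hsp, sat_split_flat (hflat _ _), sat_split_entry, sat_fold_and,
    sat_verum, true_and, sat_constant hsp, Function.update_self,
    Function.update_of_ne (zero_ne_one : (0 : Fin 4) ≠ 1)]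

theorem sat_indep_iff {A : Fin 4 × Bool → List PureFormula}
    (hA : ∀ v, A (v, true) = A (v, false)) (h₃ : A (3, false) = A (0, false)) :
    (Atom.indep (A (0, false)) (A (2, false)) (A (1, false))).Sat T ↔
      ¬ (indepTemplate.inst .split A fun _ => 0).Sat T := by
  simp only [indepTemplate, sat_fold_bor, not_sat_falsum, false_or, sat_someBool, sat_split_entry,
    Function.update_self]
  rw [← not_iff_not, not_not]
  simp only [Atom.Sat]
  push Not
  have hne (c d : Bool) (h : c = d) : c ≠ !d := by simp [h]
  constructor
  · rintro ⟨t, ht, s, hs, hγ, h⟩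
    have hα : t.values (A (0, false)) ≠ s.values (A (0, false)) := fun h' =>
      h s hs (Assignment.values_append_eq_iff.2 ⟨h', hγ⟩) rfl
    have hβ : t.values (A (1, false)) ≠ s.values (A (1, false)) := fun h' =>
      h t ht rfl h'.symm
    obtain ⟨j, hj, hj'⟩ := (Assignment.values_ne_iff rfl).1 hα
    obtain ⟨l, hl, hl'⟩ := (Assignment.values_ne_iff rfl).1 hβ
    rw [Assignment.values_eq_iff rfl] at hγ
    have htj : t.nth (A (0, false)) j = !s.nth (A (0, false)) j := Bool.eq_not.2 hj'
    have hsl : s.nth (A (1, false)) l = !t.nth (A (1, false)) l := Bool.eq_not.2 hl'.symm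
    -- The assignments with the value of `s` at the entry `j` of `α` are split off, except for `s`.
    set T₀ : Team Φ :=
      {u ∈ T | u = s ∨ u.nth (A (0, false)) j = !s.nth (A (0, false)) j} with hT₀
    have hsT₀ : s ∈ T₀ := ⟨hs, .inl rfl⟩
    have htT₀ : t ∈ T₀ := ⟨ht, .inr htj⟩
    have huniq : ∀ u ∈ T₀, u.nth (A (0, false)) j = s.nth (A (0, false)) j → u = s :=
      fun u hu h' => hu.2.resolve_right (hne _ _ h')
    refine ⟨j, hj, s.nth (A (0, false)) j, T₀, fun u hu => hu.1, ?_, ?_⟩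
    · intro u hu hn
      by_contra hb
      exact hn ⟨hu, .inr (Bool.eq_not.2 hb)⟩
    -- `T₁` and `T₂` are what remains for the bases of the two instances of `separate`: the
    -- assignments not yet told apart from `s` on `β` and `γ`; `t` is kept in spite of `β`.
    set T₁ : Team Φ := {u ∈ T₀ | u = t ∨
      ∀ i < (A (1, false)).length, s.nth (A (1, false)) i = u.nth (A (1, false)) i} with hT₁
    set T₂ : Team Φ := {u ∈ T₁ | ∀ i < (A (2, false)).length,
      s.nth (A (2, false)) i = u.nth (A (2, false)) i} with hT₂
    have hsT₁ : s ∈ T₁ := ⟨hsT₀, .inr fun _ _ => rfl⟩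
    have hsT₂ : s ∈ T₂ := ⟨hsT₁, fun _ _ => rfl⟩
    have htT₂ : t ∈ T₂ := ⟨⟨htT₀, .inl rfl⟩, fun i hi => (hγ i hi).symm⟩
    have hT₁₀ : T₁ ⊆ T₀ := fun u hu => hu.1
    have hT₂₁ : T₂ ⊆ T₁ := fun u hu => hu.1
    refine sat_separate_of_unique (x := (0, false)) (v := (1 : Fin 4)) zero_ne_one hsT₀
      (by simp) (by simpa using huniq) hT₁₀ ?_ hsT₁ ?_
    · refine sat_separate_of_unique (x := (0, false)) (v := (2 : Fin 4)) (by simp) hsT₁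
        (by simp) (by simpa using fun u hu => huniq u (hT₁₀ hu)) hT₂₁ ?_ hsT₂ ?_
      · simp only [sat_indepCore, Function.update_self]
        refine ⟨⟨s, hsT₂, rfl⟩, l, hl, t.nth (A (1, false)) l, ?_, ⟨{t, s}, ?_, ?_, ?_⟩,
          {u ∈ T₂ | u.nth (A (0, false)) j = !s.nth (A (0, false)) j}, fun u hu => hu.1, ?_, ?_⟩
        · intro u hu hub
          rw [huniq u (hT₁₀ (hT₂₁ hu)) hub, hsl]
        · exact Set.pair_subset htT₂ hsT₂
        · intro u hu hn
          simp only [Set.mem_insert_iff, Set.mem_singleton_iff, not_or] at hn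
          refine ⟨(hT₁₀ (hT₂₁ hu)).2.resolve_left hn.2, ?_⟩
          rw [← (hT₂₁ hu).2.resolve_left hn.1 l hl, hsl]
        · rintro i hi
          refine ⟨s.nth (A (2, false)) i, ?_⟩
          rintro u (rfl | rfl)
          exacts [hγ i hi, rfl]
        · intro u hu hn
          by_contra hb
          exact hn ⟨hu, Bool.eq_not.2 hb⟩
        · refine sat_isolate_of_unique (P := fun _ => True) (s := t) (by simp)
            (fun _ => iff_of_true sat_verum fun _ _ => trivial) ⟨htT₂, htj⟩ (by simp) trivial ?_ ?_
          · rintro u ⟨hu, -⟩ hul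
            by_contra hn
            have := (hT₂₁ hu).2.resolve_left hn l hl
            simp only [Function.update_self] at hul
            rw [hul, hsl] at this
            simp at this
          · rintro u ⟨hu, -⟩ hul
            simp only [Function.update_self] at hul
            rw [hA, h₃]
            by_contra! hn
            have hut : u ≠ t := fun e => by
              rw [e] at hul
              simp at hul
            refine h u (hT₁₀ (hT₂₁ hu)).1 (Assignment.values_append_eq_iff.2
              ⟨(Assignment.values_eq_iff rfl).2 hn,
                (Assignment.values_eq_iff rfl).2 fun i hi => ?_⟩)
              ((Assignment.values_eq_iff rfl).2 ((hT₂₁ hu).2.resolve_left hut))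
            rw [hγ i hi, hu.2 i hi]
      · intro u hu _ hag
        rw [hA] at hag
        exact ⟨hu, hag⟩
    · intro u hu _ hag
      rw [hA] at hag
      exact ⟨hu, .inr hag⟩
  · -- Conversely, `s` is an assignment with the value `b` that is left for `indepCore`, and `t` is
    -- the one that `isolate` provides.
    rintro ⟨j, hj, b, T₀, hT₀, hout, hsat⟩
    obtain ⟨T₁, hT₁, hsat₁, hsep₁⟩ := exists_of_sat_separate (x := (0, false)) (by simp) hsat
    obtain ⟨T₂, hT₂, hsat₂, hsep₂⟩ := exists_of_sat_separate (x := (0, false)) (by simp) hsat₁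
    simp only [hA, Function.update_self] at hsep₁ hsep₂
    simp only [sat_indepCore, Function.update_self] at hsat₂
    obtain ⟨⟨s, hs, hsb⟩, l, hl, d, hd, ⟨Y, hY, hYout, hγ⟩, W, hW, hWout, hiso⟩ := hsat₂
    obtain ⟨t, ht, htd, -, hiso⟩ := exists_of_sat_isolate (P := fun _ => True) (by simp)
      (fun _ => iff_of_true sat_verum fun _ _ => trivial) hiso
    simp only [Function.update_self, hA, h₃] at htd hiso
    have htY : t ∈ Y := by
      by_contra hn
      exact hne _ _ htd (hYout t (hW ht) hn).2
    have hsY : s ∈ Y := by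
      by_contra hn
      exact hne _ _ hsb (hYout s hs hn).1
    have htb : t.nth (A (0, false)) j = !b :=
      Bool.eq_not.2 fun h => hne _ _ htd (hd t (hW ht) h)
    have hT₂T : T₂ ⊆ T := hT₂.trans (hT₁.trans hT₀)
    refine ⟨t, hT₂T (hW ht), s, hT₂T hs, (Assignment.values_eq_iff rfl).2 fun i hi => ?_, ?_⟩
    · obtain ⟨e, he⟩ := hγ i hi
      rw [he t htY, he s hsY]
    intro u hu huαγ huβ
    obtain ⟨huα, huγ⟩ := Assignment.values_append_eq_iff.1 huαγ
    rw [Assignment.values_eq_iff rfl] at huα huγ huβ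
    have hub : u.nth (A (0, false)) j = !b := by rw [← huα j hj, htb]
    have hu₀ : u ∈ T₀ := by
      by_contra hn
      exact hne _ _ (hout u hu hn) hub
    have hu₁ : u ∈ T₁ := hsep₁ s (hT₁ (hT₂ hs)) hsb u hu₀ hub huβ
    have hu₂ : u ∈ T₂ := hsep₂ s (hT₂ hs) hsb u hu₁ hub fun i hi => by
      obtain ⟨e, he⟩ := hγ i hi
      rw [← huγ i hi, he t htY, he s hsY]
    have huW : u ∈ W := by
      by_contra hn
      exact hne _ _ (hWout u hu₂ hn) hub
    obtain ⟨i, hi, hne'⟩ := hiso u huW (by rw [← huβ l hl, hd s hs hsb])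
    exact hne' (huα i hi)

theorem independenceBound {S : Set Connective} (hbor : Connective.bin BinConn.bor ∈ S)
    (hand : Connective.bin BinConn.and ∈ S) (hS : Connective.bin BinConn.split ∈ S) :
    IndependenceBound S := by
  refine negationDefinable (t := indepTemplate) (τ := fun y => ![0, 1, 2, 0] y.1) hand hS
    (fun x => [x.1, x.2.1, x.2.2]) (fun x => by simp [TupleTriple.encode])
    (fun x y => ?_) (fun x v => rfl) ?_ ?_ (fun x Φ T => ?_) 5000 fun x => ?_
  · rcases y with ⟨v, b⟩
    fin_cases v <;> simp
  · simp [indepTemplate, indepCore, WellScoped, verum, falsum, someBool, someVal,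
      Template.nonempty, constant, compareVals, whereVal, isolate, separate]
  · refine ⟨hbor, over_falsum, over_someBool hbor fun b => ⟨hS, trivial,
      over_separate hbor hand hS _ _ _ (over_separate hbor hand hS _ _ _ ⟨hand,
        over_someVal hand hS _ _, hbor, over_falsum, over_someBool hbor fun d => ⟨hand,
          over_whereVal hS _ _ _ _, hand, ⟨hS, ⟨hand, trivial, trivial⟩, hand, over_verum,
            over_constant hbor _⟩, hS, trivial, over_isolate hbor hand hS _ _ _ over_verum⟩⟩)⟩⟩
  · exact sat_indep_iff (A := fun y => [x.1, x.2.1, x.2.2].getD (![0, 1, 2, 0] y.1) [])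
      (fun _ => rfl) rfl
  · obtain ⟨α, β, γ⟩ := x
    dsimp only
    have h₁ := length_le_tupleLength α
    have h₂ := length_le_tupleLength β
    have h₃ := length_le_tupleLength γ
    have hα := tupleLength_le_length_mul α
    simp [indepTemplate, indepCore, size, falsum, verum, someBool, constant, whereVal, size_someVal,
      size_separate, size_isolate, Finset.sum_add_distrib, ← Finset.mul_sum, sum_lengthAt]
    generalize tupleLength α = a at *
    generalize tupleLength β = b at *
    generalize tupleLength γ = c at *
    generalize α.length = n at *
    generalize β.length = m at *
    generalize γ.length = k at *
    -- These facts bound all monomials in the size by the nine monomials of the bound.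
    have hn := Nat.le_mul_self n
    have e₁ := Nat.mul_le_mul_left n hα
    have e₂ := Nat.mul_le_mul_left m hα
    have e₃ := Nat.mul_le_mul_left k hα
    have e₄ := Nat.mul_le_mul_right b hn
    have e₅ := Nat.mul_le_mul_right c hn
    have e₆ := Nat.mul_le_mul_left n h₂
    have e₇ := Nat.mul_le_mul_left n h₃
    have e₈ := Nat.mul_le_mul_left (n * m) h₃
    have e₉ := Nat.mul_le_mul_left (n * n) h₂
    have hX : n * n * a + n * n * b + n * n * c + n * m * a + n * m * b + n * m * c + n * k * a +
        n * k * b + n * k * c = n * (n + m + k) * (a + b + c) := by ring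
    have e₁₀ := le_max_left (n * (n + m + k) * (a + b + c)) 1
    have e₁₁ := le_max_right (n * (n + m + k) * (a + b + c)) 1
    rw [← hX] at *
    ring_nf at *
    omega

end TeamLogic

theorem mainTheorem3 (S : Set TeamLogic.Connective) :
    (({TeamLogic.Connective.bin TeamLogic.BinConn.bor,
        TeamLogic.Connective.bin TeamLogic.BinConn.and,
        TeamLogic.Connective.bin TeamLogic.BinConn.split} : Set TeamLogic.Connective) ⊆ S →
      TeamLogic.DependenceBound S ∧ TeamLogic.ExclusionBound S ∧ TeamLogic.InclusionBound S ∧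
        TeamLogic.IndependenceBound S ∧ TeamLogic.UnaryAnonymityBound S) ∧
    (({TeamLogic.Connective.bin TeamLogic.BinConn.bor,
        TeamLogic.Connective.bin TeamLogic.BinConn.and,
        TeamLogic.Connective.bin TeamLogic.BinConn.strictSplit} : Set TeamLogic.Connective) ⊆ S →
      TeamLogic.DependenceBound S ∧ TeamLogic.ExclusionBound S) := by
  open TeamLogic in
  constructor
  · intro h
    have hbor : Connective.bin .bor ∈ S := h (by simp)
    have hand : Connective.bin .and ∈ S := h (by simp)
    have hsplit : Connective.bin .split ∈ S := h (by simp)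
    exact ⟨dependenceBound (.inl rfl) hbor hand hsplit, exclusionBound (.inl rfl) hbor hand hsplit,
      inclusionBound hbor hand hsplit, independenceBound hbor hand hsplit,
      unaryAnonymityBound hbor hand hsplit⟩
  · intro h
    have hbor : Connective.bin .bor ∈ S := h (by simp)
    have hand : Connective.bin .and ∈ S := h (by simp)
    have hstrict : Connective.bin .strictSplit ∈ S := h (by simp)
    exact ⟨dependenceBound (.inr rfl) hbor hand hstrict,
      exclusionBound (.inr rfl) hbor hand hstrict⟩
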